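/- **Setting.** Let $\Gamma\subset SL(2,\mathbb C)$ be a finite subgroup, $\Gamma'\subset\Gamma$ a central subgroup, and $L=\mathbb C^2$ the tautological representation with its standard symplectic form and a $\Gamma$-invariant hermitian inner product. For a finite group $G\subset SL(2,\mathbb C)$ preserving this inner product (below $G=\Gamma$ or $\Gamma'$), let $R_0,\dots,R_{d-1}$ be its irreducible representations. A parameter for $G$ is a pair $\zeta=(\zeta_{\mathbb C},\zeta_{\mathbb R})$ of elements of the center $Z(\mathbb C[G])$, where $\zeta_{\mathbb C}$ acts on $R_k$ by a scalar $\zeta_{\mathbb C}^k\in\mathbb C$ and $\zeta_{\mathbb R}$ acts on $R_k$ by a real scalar $\zeta_{\mathbb R}^k\in\mathbb R$. For finite-dimensional unitary representations $V,W$ of $G$ with classes $\mathbf v,\mathbf w$, the quiver variety is the quotient space $$\mathfrak M^G_\zeta(\mathbf v,\mathbf w)=\left\{(B,i,j)\ \middle|\ [B,B]+ij=-\zeta_{\mathbb C},\ [B,B^\dagger]+ii^\dagger-j^\dagger j=-\zeta_{\mathbb R}\right\}\Big/U_G(V),$$ where $(B,i,j)\in \mathrm{Hom}_G(V\otimes L,V)\oplus\mathrm{Hom}_G(W,V)\oplus\mathrm{Hom}_G(V,W)$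 and $g\in U_G(V)$ acts by $(gBg^{-1},gi,jg^{-1})$ (that is, $gB(g^{-1}\otimes 1)$ for $B:V\otimes L\to V$). Let $A=(a_{k,l})$, where $a_{k,l}$ is the multiplicity of $R_l$ in $R_k\otimes L$, and $C=2I-A$. The parameter $\zeta$ is generic with respect to $\mathbf v$ if there is no $\theta\in(\mathbb Z_{\ge0})^d\setminus\{0\}$ with ${}^t\theta C\theta\le2$, $\theta_k\le\mathbf v_k$ for all $k$, and $\sum_k\zeta_{\mathbb C}^k\theta_k=\sum_k\zeta_{\mathbb R}^k\theta_k=0$. **Theorem.** Let $V,W$ be finite-dimensional unitary representations of $\Gamma$ with classes $\mathbf v,\mathbf w$, and let $\mathbf v'=\mathbf v|_{\Gamma'}$, $\mathbf w'=\mathbf w|_{\Gamma'}$ be the classes of their restrictions to $\Gamma'$. Let $\zeta$ be a parameter for $\Gamma'$ that is generic with respect to $\mathbf v'$, and let $\sigma^*\zeta$ be its image under the inclusion $Z(\mathbb C[\Gamma'])\subset Z(\mathbb C[\Gamma])$. For $\gamma\in\Gamma$ put $B^\gamma=B\circ(1\otimes\gamma)$, $i^\gamma=i\gamma$, $j^\gamma=\gamma^{-1}j$;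 this induces an action of $\Gamma$ on $\mathfrak M^{\Gamma'}_\zeta(\mathbf v',\mathbf w')$. 1. If $(B,i,j)$ represents a $\Gamma$-fixed point of $\mathfrak M^{\Gamma'}_\zeta(\mathbf v',\mathbf w')$, then for each $\gamma\in\Gamma$ there is a unique $g_\gamma\in U_{\Gamma'}(V)$ with $g_\gamma Bg_\gamma^{-1}=B^\gamma$, $g_\gamma i=i^\gamma$, $jg_\gamma^{-1}=j^\gamma$, and $\gamma\mapsto g_\gamma$ is a representation of $\Gamma$ on $V$ extending the given representation of $\Gamma'$. 2. Let $\left(\mathfrak M^{\Gamma'}_\zeta(\mathbf v',\mathbf w')\right)^\Gamma_{\mathbf v}$ be the set of $\Gamma$-fixed points for which the representation $\gamma\mapsto g_\gamma$ has class $\mathbf v$, i.e. is isomorphic to $V$. Regarding a triple for $\Gamma$ and $\sigma^*\zeta$ as a triple for $\Gamma'$ and $\zeta$ induces a well-defined homeomorphism $$\mathfrak M^\Gamma_{\sigma^*\zeta}(\mathbf v,\mathbf w)\;\xrightarrow{\ \sim\ }\;\left(\mathfrak M^{\Gamma'}_\zeta(\mathbf v',\mathbf w')\right)^\Gamma_{\mathbf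 v}.$$ -/

import Mathlib

open scoped Matrix ComplexOrder

set_option linter.unusedSectionVars false

namespace QuiverVariety

/-- `SL(2, ℂ)`, acting on `L = ℂ²` in the tautological way. -/
abbrev SL2 : Type := Matrix.SpecialLinearGroup (Fin 2) ℂ

section Parameters

variable {G : Type*} [Group G]

/-- A parameter `ζ = (ζ_ℂ, ζ_ℝ)` for a finite group `G`. The complex part is an element of the
center of `ℂ[G]`, which is `ℂ^d` through the scalars `ζ_ℂ^k` by which it acts on the irreducible
representations `R_k`. The real part is an element of the real form `ℝ^d` of this center, that is,
a central element acting on every `R_k` by a *real* scalar `ζ_ℝ^k`; since the `R_k` are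
unitarizable, these are the central elements `z = ∑ z_g g` with `z_{g⁻¹} = conj z_g`. -/
structure Parameter (G : Type*) [Group G] where
  c : MonoidAlgebra ℂ G
  r : MonoidAlgebra ℂ G
  c_central : c ∈ Subalgebra.center ℂ (MonoidAlgebra ℂ G)
  r_central : r ∈ Subalgebra.center ℂ (MonoidAlgebra ℂ G)
  r_real : ∀ g : G, r.coeff g⁻¹ = star (r.coeff g)

/-- The scalar `z^χ` by which `z ∈ ℂ[G]` acts on the one-dimensional representation `χ`. -/
noncomputable def charValue (z : MonoidAlgebra ℂ G) (χ : G →* ℂˣ) : ℂ :=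
  MonoidAlgebra.lift ℂ ℂ G ((Units.coeHom ℂ).comp χ) z

/-- The `χ`-isotypic part of a representation `a` of `G`; its dimension is the multiplicity of the
one-dimensional representation `χ`. -/
def weightSpace {M : Type*} [AddCommGroup M] [Module ℂ M] (a : G → Module.End ℂ M)
    (χ : G →* ℂˣ) : Submodule ℂ M :=
  ⨅ g, Module.End.eigenspace (a g) (χ g : ℂ)

end Parameters

section McKay

variable {Γ : Subgroup SL2}

/-- The number `a_{χ,ψ}`: the multiplicity of `ψ` in `χ ⊗ L`, i.e. the adjacency matrix of the
affine Dynkin graph attached to an abelian `Γ`, whose vertices are the irreducible representations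
(the characters `Γ →* ℂˣ`). -/
noncomputable def adjacency (χ ψ : Γ →* ℂˣ) : ℕ :=
  Module.finrank ℂ
    (weightSpace (fun γ : Γ => (χ γ : ℂ) • Matrix.mulVecLin (γ : SL2).1) ψ)

open Classical in
/-- The generalized Cartan matrix `C = 2 I - A`. -/
noncomputable def cartan (χ ψ : Γ →* ℂˣ) : ℤ :=
  (if χ = ψ then 2 else 0) - (adjacency χ ψ : ℤ)

/-- The positive roots: nonzero `θ ∈ (ℤ_{≥0})^d` with `ᵗθ C θ ≤ 2`. (A finite abelian group has
finitely many characters, so finite support is no restriction.) -/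
def IsPositiveRoot (θ : (Γ →* ℂˣ) →₀ ℕ) : Prop :=
  θ ≠ 0 ∧ (θ.sum fun χ m => θ.sum fun ψ n => (m : ℤ) * cartan χ ψ * (n : ℤ)) ≤ 2

end McKay

variable {V W : Type*} [NormedAddCommGroup V] [InnerProductSpace ℂ V] [CompleteSpace V]
  [NormedAddCommGroup W] [InnerProductSpace ℂ W] [CompleteSpace W]

/-- The data on which the quiver variety of `Γ ⊂ SL(2, ℂ)` depends: unitary representations of `Γ`
on the hermitian vector spaces `V` and `W`, and a `Γ`-invariant hermitian inner product
`⟨x, y⟩ = xᴴ h y` on `L = ℂ²`. -/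
structure Datum (Γ : Subgroup SL2) (V W : Type*)
    [NormedAddCommGroup V] [InnerProductSpace ℂ V] [CompleteSpace V]
    [NormedAddCommGroup W] [InnerProductSpace ℂ W] [CompleteSpace W] where
  rhoV : Γ →* unitary (V →L[ℂ] V)
  rhoW : Γ →* unitary (W →L[ℂ] W)
  h : Matrix (Fin 2) (Fin 2) ℂ
  h_posDef : h.PosDef
  h_invariant : ∀ γ : Γ, (γ : SL2).1ᴴ * h * (γ : SL2).1 = h

/-- Restriction of all the data to a subgroup. -/
noncomputable def Datum.restrict {Γ Γ' : Subgroup SL2} (D : Datum Γ V W) (hle : Γ' ≤ Γ) : Datum Γ' V W where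
  rhoV := D.rhoV.comp (Subgroup.inclusion hle)
  rhoW := D.rhoW.comp (Subgroup.inclusion hle)
  h := D.h
  h_posDef := D.h_posDef
  h_invariant γ := D.h_invariant (Subgroup.inclusion hle γ)

/-- Triples `(B, i, j)` of linear maps `B : V ⊗ L → V`, `i : W → V`, `j : V → W`. The map `B` is
recorded by its two components `B_a = B (· ⊗ e_a)`, with `e_0, e_1` the standard basis of `L`. -/
abbrev Triple (V W : Type*) [NormedAddCommGroup V] [InnerProductSpace ℂ V]
    [NormedAddCommGroup W] [InnerProductSpace ℂ W] : Type _ :=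
  (Fin 2 → V →L[ℂ] V) × (W →L[ℂ] V) × (V →L[ℂ] W)

/-- The composition `B ∘ (1 ⊗ γ)`. -/
noncomputable def precompL (γ : SL2) (B : Fin 2 → V →L[ℂ] V) : Fin 2 → V →L[ℂ] V :=
  fun a => ∑ b, γ.1 b a • B b

/-- `[B, B]`, the composition `V → V ⊗ L ⊗ L → V ⊗ L → V` formed with the inverse of the standard
symplectic form of `L`. -/
noncomputable def complexBracket (B : Fin 2 → V →L[ℂ] V) : V →L[ℂ] V :=
  B 0 * B 1 - B 1 * B 0

/-- `[B, B†] = B B† - B† B`, formed with the inner product `h` of `L`. In terms of an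
`h`-orthonormal basis `f_0, f_1` of `L` and `B(f_a) = B (· ⊗ f_a)` this is
`∑ a, (B(f_a) B(f_a)† - B(f_a)† B(f_a))`. -/
noncomputable def realBracket (h : Matrix (Fin 2) (Fin 2) ℂ) (B : Fin 2 → V →L[ℂ] V) :
    V →L[ℂ] V :=
  ∑ a, ∑ b, h⁻¹ a b • (B a * star (B b) - star (B b) * B a)

/-- The action `(B, i, j) ↦ (g B g⁻¹, g i, j g⁻¹)` of the unitary group of `V`. -/
noncomputable def gauge (g : unitary (V →L[ℂ] V)) (x : Triple V W) : Triple V W :=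
  (fun a => (g : V →L[ℂ] V) * x.1 a * ((g⁻¹ : unitary (V →L[ℂ] V)) : V →L[ℂ] V),
    (g : V →L[ℂ] V) ∘L x.2.1,
    x.2.2 ∘L ((g⁻¹ : unitary (V →L[ℂ] V)) : V →L[ℂ] V))

theorem gauge_one (x : Triple V W) : gauge 1 x = x := by
  refine Prod.ext ?_ (Prod.ext ?_ ?_)
  · funext a; simp [gauge]
  · ext; simp [gauge]
  · ext; simp [gauge]

theorem gauge_mul (g k : unitary (V →L[ℂ] V)) (x : Triple V W) :
    gauge (g * k) x = gauge g (gauge k x) := by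
  refine Prod.ext ?_ (Prod.ext ?_ ?_)
  · funext a; simp [gauge, mul_assoc]
  · ext; simp [gauge]
  · ext; simp [gauge]

/-- The action of an element of the group algebra of `G` on a unitary representation of `G`. -/
noncomputable def groupAlgebraAction {G : Type*} [Group G] (ρ : G →* unitary (V →L[ℂ] V)) :
    MonoidAlgebra ℂ G →ₐ[ℂ] (V →L[ℂ] V) :=
  MonoidAlgebra.lift ℂ (V →L[ℂ] V) G ((unitary (V →L[ℂ] V)).subtype.comp ρ)

namespace Datum

variable {Γ Γ' : Subgroup SL2}

/-- `(B, i, j) ↦ (B ∘ (1 ⊗ γ), i ∘ γ, γ⁻¹ ∘ j)`. -/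
noncomputable def twist (D : Datum Γ V W) (γ : Γ) (x : Triple V W) : Triple V W :=
  (precompL γ x.1, x.2.1 ∘L (D.rhoW γ : W →L[ℂ] W), (D.rhoW γ⁻¹ : W →L[ℂ] W) ∘L x.2.2)

/-- `(B, i, j) ∈ Hom_Γ(V ⊗ L, V) ⊕ Hom_Γ(W, V) ⊕ Hom_Γ(V, W)`. -/
def IsEquivariant (D : Datum Γ V W) (x : Triple V W) : Prop :=
  (∀ (γ : Γ) (a : Fin 2),
    (D.rhoV γ : V →L[ℂ] V) * x.1 a = precompL γ x.1 a * (D.rhoV γ : V →L[ℂ] V)) ∧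
  (∀ γ : Γ, (D.rhoV γ : V →L[ℂ] V) ∘L x.2.1 = x.2.1 ∘L (D.rhoW γ : W →L[ℂ] W)) ∧
  (∀ γ : Γ, (D.rhoW γ : W →L[ℂ] W) ∘L x.2.2 = x.2.2 ∘L (D.rhoV γ : V →L[ℂ] V))

/-- The `Γ`-equivariant triples with
`[B, B] + i j = -ζ_ℂ` and `[B, B†] + i i† - j† j = -ζ_ℝ` on `V`. -/
def level (D : Datum Γ V W) (ζ : Parameter Γ) : Set (Triple V W) :=
  {x | D.IsEquivariant x ∧
    complexBracket x.1 + x.2.1 ∘L x.2.2 = -groupAlgebraAction D.rhoV ζ.c ∧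
    realBracket D.h x.1 + x.2.1 ∘L ContinuousLinearMap.adjoint x.2.1
      - ContinuousLinearMap.adjoint x.2.2 ∘L x.2.2 = -groupAlgebraAction D.rhoV ζ.r}

/-- `U_Γ(V)`, the group of `Γ`-equivariant unitary automorphisms of `V`. -/
noncomputable def gaugeGroup (D : Datum Γ V W) : Subgroup (unitary (V →L[ℂ] V)) :=
  Subgroup.centralizer (Set.range D.rhoV)

/-- Two points of the level set are equivalent if they lie in one `U_Γ(V)`-orbit. -/
noncomputable def orbitSetoid (D : Datum Γ V W) (ζ : Parameter Γ) : Setoid (D.level ζ) where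
  r x y := ∃ g ∈ D.gaugeGroup, gauge g (x : Triple V W) = y
  iseqv :=
    { refl := fun x => ⟨1, D.gaugeGroup.one_mem, gauge_one _⟩
      symm := by
        rintro x y ⟨g, hg, hxy⟩
        refine ⟨g⁻¹, D.gaugeGroup.inv_mem hg, ?_⟩
        rw [← hxy, ← gauge_mul, inv_mul_cancel, gauge_one]
      trans := by
        rintro x y z ⟨g, hg, hxy⟩ ⟨k, hk, hyz⟩
        refine ⟨k * g, D.gaugeGroup.mul_mem hk hg, ?_⟩
        rw [gauge_mul, hxy, hyz] }

/-- The quiver variety `𝔐^Γ_ζ(v, w)`, with `v`, `w` the classes of `V`, `W`. -/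
noncomputable def variety (D : Datum Γ V W) (ζ : Parameter Γ) : Type _ :=
  Quotient (D.orbitSetoid ζ)

/-- The quotient topology. -/
instance (D : Datum Γ V W) (ζ : Parameter Γ) : TopologicalSpace (D.variety ζ) :=
  inferInstanceAs (TopologicalSpace (Quotient (D.orbitSetoid ζ)))

/-- The point of the quiver variety represented by a triple. -/
noncomputable def point (D : Datum Γ V W) (ζ : Parameter Γ) (x : D.level ζ) : D.variety ζ :=
  Quotient.mk (D.orbitSetoid ζ) x

/-- For abelian `Γ`: the parameter `ζ` is generic with respect to `v`, i.e.
`ζ ∉ ℝ³ ⊗ D_θ` for every positive root `θ ≤ v`, where `D_θ = {x | ∑ x_k θ_k = 0}`. -/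
def IsGeneric (D : Datum Γ V W) (ζ : Parameter Γ) : Prop :=
  ∀ θ : (Γ →* ℂˣ) →₀ ℕ, IsPositiveRoot θ →
    (∀ χ, θ χ ≤ Module.finrank ℂ
      (weightSpace (fun γ => ((D.rhoV γ : V →L[ℂ] V) : Module.End ℂ V)) χ)) →
    ¬ ((θ.sum fun χ m => (m : ℂ) * charValue ζ.c χ) = 0 ∧
       (θ.sum fun χ m => (m : ℂ) * charValue ζ.r χ) = 0)

end Datum

section CentralSubgroup

variable {Γ Γ' : Subgroup SL2}

/-- The image of the group algebra of a central subgroup is central. -/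
theorem mapDomain_mem_center (hle : Γ' ≤ Γ) (hc : ∀ a ∈ Γ', ∀ b ∈ Γ, a * b = b * a)
    (z : MonoidAlgebra ℂ Γ') :
    MonoidAlgebra.mapDomainAlgHom ℂ ℂ (Subgroup.inclusion hle) z ∈
      Subalgebra.center ℂ (MonoidAlgebra ℂ Γ) := by
  rw [Subalgebra.mem_center_iff]
  intro y
  induction z using MonoidAlgebra.induction_linear with
  | zero => simp
  | add f g hf hg => simp only [map_add, mul_add, add_mul, hf, hg]
  | single a r =>
    induction y using MonoidAlgebra.induction_linear with
    | zero => simp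
    | add f g hf hg => simp only [mul_add, add_mul, hf, hg]
    | single b t =>
      have : b * Subgroup.inclusion hle a = Subgroup.inclusion hle a * b :=
        Subtype.ext (hc a a.2 b b.2).symm
      simp [MonoidAlgebra.single_mul_single, this, mul_comm]

theorem mapDomain_real (hle : Γ' ≤ Γ) (z : MonoidAlgebra ℂ Γ')
    (hz : ∀ g : Γ', z.coeff g⁻¹ = star (z.coeff g)) (g : Γ) :
    (MonoidAlgebra.mapDomainAlgHom ℂ ℂ (Subgroup.inclusion hle) z).coeff g⁻¹ =
      star ((MonoidAlgebra.mapDomainAlgHom ℂ ℂ (Subgroup.inclusion hle) z).coeff g) := by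
  change Finsupp.mapDomain (Subgroup.inclusion hle) z.coeff g⁻¹ =
    star (Finsupp.mapDomain (Subgroup.inclusion hle) z.coeff g)
  have hinj := Subgroup.inclusion_injective hle
  by_cases hg : (g : SL2) ∈ Γ'
  · have h1 : g = Subgroup.inclusion hle ⟨g, hg⟩ := rfl
    rw [h1, ← map_inv, Finsupp.mapDomain_apply hinj, Finsupp.mapDomain_apply hinj, hz]
  · rw [Finsupp.mapDomain_of_notMem_range, Finsupp.mapDomain_of_notMem_range, star_zero]
    · rintro ⟨k, rfl⟩
      exact hg k.2
    · rintro ⟨k, hk⟩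
      apply hg
      have : g = (Subgroup.inclusion hle k)⁻¹ := by rw [hk, inv_inv]
      rw [this]
      exact Γ'.inv_mem k.2

/-- `σ^*`: the parameter for `Γ` induced by a parameter for a central subgroup `Γ'`, through the
inclusion `ℂ[Γ'] ⊂ ℂ[Γ]`. -/
noncomputable def Parameter.sigma (hle : Γ' ≤ Γ) (hc : ∀ a ∈ Γ', ∀ b ∈ Γ, a * b = b * a)
    (ζ : Parameter Γ') : Parameter Γ where
  c := MonoidAlgebra.mapDomainAlgHom ℂ ℂ (Subgroup.inclusion hle) ζ.c
  r := MonoidAlgebra.mapDomainAlgHom ℂ ℂ (Subgroup.inclusion hle) ζ.r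
  c_central := mapDomain_mem_center hle hc ζ.c
  r_central := mapDomain_mem_center hle hc ζ.r
  r_real := mapDomain_real hle ζ.r ζ.r_real

theorem groupAlgebraAction_mapDomain (hle : Γ' ≤ Γ) (ρ : Γ →* unitary (V →L[ℂ] V))
    (z : MonoidAlgebra ℂ Γ') :
    groupAlgebraAction ρ (MonoidAlgebra.mapDomainAlgHom ℂ ℂ (Subgroup.inclusion hle) z) =
      groupAlgebraAction (ρ.comp (Subgroup.inclusion hle)) z := by
  induction z using MonoidAlgebra.induction_linear with
  | zero => simp
  | add f g hf hg => simp only [map_add, hf, hg]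
  | single a r => simp [groupAlgebraAction, MonoidAlgebra.lift_single]

theorem precompL_mul (γ δ : SL2) (B : Fin 2 → V →L[ℂ] V) :
    precompL (γ * δ) B = precompL δ (precompL γ B) := by
  funext a
  fin_cases a <;>
  · simp only [precompL, Matrix.SpecialLinearGroup.coe_mul, Matrix.mul_apply, Fin.sum_univ_two]
    module

theorem complexBracket_precompL (γ : SL2) (B : Fin 2 → V →L[ℂ] V) :
    complexBracket (precompL γ B) = complexBracket B := by
  have hdet : γ.1 0 0 * γ.1 1 1 - γ.1 0 1 * γ.1 1 0 = 1 := by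
    rw [← Matrix.det_fin_two]; exact γ.2
  have : complexBracket (precompL γ B) =
      (γ.1 0 0 * γ.1 1 1 - γ.1 0 1 * γ.1 1 0) • complexBracket B := by
    simp only [complexBracket, precompL, Fin.sum_univ_two, mul_add, add_mul, smul_mul_assoc,
      mul_smul_comm]
    module
  rw [this, hdet, one_smul]

theorem inv_invariant (h : Matrix (Fin 2) (Fin 2) ℂ) (γ : SL2)
    (hγ : γ.1ᴴ * h * γ.1 = h) : γ.1 * h⁻¹ * γ.1ᴴ = h⁻¹ := by
  have hu : IsUnit γ.1.det := by rw [γ.2]; exact isUnit_one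
  have hu' : IsUnit γ.1ᴴ.det := by rw [Matrix.det_conjTranspose, γ.2]; simp
  calc γ.1 * h⁻¹ * γ.1ᴴ = γ.1 * (γ.1ᴴ * h * γ.1)⁻¹ * γ.1ᴴ := by rw [hγ]
    _ = (γ.1 * γ.1⁻¹) * h⁻¹ * ((γ.1ᴴ)⁻¹ * γ.1ᴴ) := by
        rw [Matrix.mul_inv_rev, Matrix.mul_inv_rev]; simp only [Matrix.mul_assoc]
    _ = h⁻¹ := by rw [Matrix.mul_nonsing_inv _ hu, Matrix.nonsing_inv_mul _ hu']; simp

theorem realBracket_precompL (h : Matrix (Fin 2) (Fin 2) ℂ) (γ : SL2)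
    (hγ : γ.1ᴴ * h * γ.1 = h) (B : Fin 2 → V →L[ℂ] V) :
    realBracket h (precompL γ B) = realBracket h B := by
  have key := inv_invariant h γ hγ
  unfold realBracket
  generalize h⁻¹ = M at key
  conv_rhs => rw [← key]
  simp only [precompL, Fin.sum_univ_two, star_add, star_smul, mul_add, add_mul, smul_mul_assoc,
    mul_smul_comm, Matrix.mul_apply, Matrix.conjTranspose_apply]
  module

namespace Datum

variable (D : Datum Γ V W)

theorem gauge_twist (g : unitary (V →L[ℂ] V)) (γ : Γ) (x : Triple V W) :
    gauge g (D.twist γ x) = D.twist γ (gauge g x) := by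
  refine Prod.ext ?_ (Prod.ext ?_ ?_)
  · funext a
    simp [gauge, twist, precompL, mul_add, add_mul]
  · rfl
  · rfl

/-- `(B, i, j) ↦ (B^γ, i^γ, j^γ)` preserves the level set of the central subgroup `Γ'`. -/
theorem twist_mem_level (hle : Γ' ≤ Γ) (hc : ∀ a ∈ Γ', ∀ b ∈ Γ, a * b = b * a)
    (ζ : Parameter Γ') (γ : Γ) (x : Triple V W) (hx : x ∈ (D.restrict hle).level ζ) :
    D.twist γ x ∈ (D.restrict hle).level ζ := by
  obtain ⟨⟨hB, hi, hj⟩, hC, hR⟩ := hx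
  have comm : ∀ δ : Γ', Subgroup.inclusion hle δ * γ = γ * Subgroup.inclusion hle δ :=
    fun δ => Subtype.ext (hc δ δ.2 γ γ.2)
  have uW : (D.rhoW γ : W →L[ℂ] W) * (D.rhoW γ⁻¹ : W →L[ℂ] W) = 1 := by
    rw [← Submonoid.coe_mul, ← map_mul]; simp
  refine ⟨⟨?_, ?_, ?_⟩, ?_, ?_⟩
  · intro δ a
    have h1 : precompL (δ : SL2) (precompL (γ : SL2) x.1)
        = precompL (γ : SL2) (precompL (δ : SL2) x.1) := by
      rw [← precompL_mul, ← precompL_mul, hc δ δ.2 γ γ.2]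
    change _ * precompL (γ : SL2) x.1 a = precompL (δ : SL2) (precompL (γ : SL2) x.1) a * _
    rw [h1]
    simp only [precompL, Finset.mul_sum, Finset.sum_mul, mul_smul_comm, smul_mul_assoc] at hB ⊢
    simp only [hB]
  · intro δ
    have h2 : (D.rhoW (Subgroup.inclusion hle δ) : W →L[ℂ] W) * (D.rhoW γ : W →L[ℂ] W) =
        (D.rhoW γ : W →L[ℂ] W) * (D.rhoW (Subgroup.inclusion hle δ) : W →L[ℂ] W) := by
      rw [← Submonoid.coe_mul, ← Submonoid.coe_mul, ← map_mul, ← map_mul, comm]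
    change _ ∘L (x.2.1 ∘L _) = (x.2.1 ∘L _) ∘L _
    rw [← ContinuousLinearMap.comp_assoc, hi δ, ContinuousLinearMap.comp_assoc,
      ContinuousLinearMap.comp_assoc]
    exact congrArg (x.2.1 ∘L ·) h2
  · intro δ
    have comm' : Subgroup.inclusion hle δ * γ⁻¹ = γ⁻¹ * Subgroup.inclusion hle δ := by
      rw [eq_inv_mul_iff_mul_eq, ← mul_assoc, ← comm, mul_inv_cancel_right]
    have h2 : (D.rhoW (Subgroup.inclusion hle δ) : W →L[ℂ] W) * (D.rhoW γ⁻¹ : W →L[ℂ] W) =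
        (D.rhoW γ⁻¹ : W →L[ℂ] W) * (D.rhoW (Subgroup.inclusion hle δ) : W →L[ℂ] W) := by
      rw [← Submonoid.coe_mul, ← Submonoid.coe_mul, ← map_mul, ← map_mul, comm']
    change _ ∘L (_ ∘L x.2.2) = (_ ∘L x.2.2) ∘L _
    rw [ContinuousLinearMap.comp_assoc, ← hj δ, ← ContinuousLinearMap.comp_assoc,
      ← ContinuousLinearMap.comp_assoc]
    exact congrArg (· ∘L x.2.2) h2
  · rw [← hC]
    have h3 : (x.2.1 ∘L (D.rhoW γ : W →L[ℂ] W)) ∘L ((D.rhoW γ⁻¹ : W →L[ℂ] W) ∘L x.2.2) =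
        x.2.1 ∘L x.2.2 := by
      change x.2.1 ∘L (((D.rhoW γ : W →L[ℂ] W) * (D.rhoW γ⁻¹ : W →L[ℂ] W)) ∘L x.2.2) = _
      rw [uW]; rfl
    change complexBracket (precompL (γ : SL2) x.1) + _ = _
    rw [complexBracket_precompL]
    exact congrArg (complexBracket x.1 + ·) h3
  · rw [← hR]
    have a1 : ContinuousLinearMap.adjoint (x.2.1 ∘L (D.rhoW γ : W →L[ℂ] W)) =
        (D.rhoW γ⁻¹ : W →L[ℂ] W) ∘L ContinuousLinearMap.adjoint x.2.1 := by
      rw [ContinuousLinearMap.adjoint_comp, map_inv]; rfl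
    have a2 : ContinuousLinearMap.adjoint ((D.rhoW γ⁻¹ : W →L[ℂ] W) ∘L x.2.2) =
        ContinuousLinearMap.adjoint x.2.2 ∘L (D.rhoW γ : W →L[ℂ] W) := by
      rw [ContinuousLinearMap.adjoint_comp, map_inv]
      congr 1
      exact star_star _
    change realBracket D.h (precompL (γ : SL2) x.1) +
        (x.2.1 ∘L (D.rhoW γ : W →L[ℂ] W)) ∘L
          ContinuousLinearMap.adjoint (x.2.1 ∘L (D.rhoW γ : W →L[ℂ] W)) -
        ContinuousLinearMap.adjoint ((D.rhoW γ⁻¹ : W →L[ℂ] W) ∘L x.2.2) ∘L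
          ((D.rhoW γ⁻¹ : W →L[ℂ] W) ∘L x.2.2) = _
    rw [a1, a2, realBracket_precompL _ _ (D.h_invariant γ)]
    change realBracket D.h x.1 +
        x.2.1 ∘L (((D.rhoW γ : W →L[ℂ] W) * (D.rhoW γ⁻¹ : W →L[ℂ] W)) ∘L
          ContinuousLinearMap.adjoint x.2.1) -
        ContinuousLinearMap.adjoint x.2.2 ∘L
          (((D.rhoW γ : W →L[ℂ] W) * (D.rhoW γ⁻¹ : W →L[ℂ] W)) ∘L x.2.2) = _
    rw [uW]
    rfl

/-- The action of `γ ∈ Γ` on the quiver variety of the central subgroup `Γ'`, sending the class of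
`(B, i, j)` to the class of `(B^γ, i^γ, j^γ)`. -/
noncomputable def act (hle : Γ' ≤ Γ) (hc : ∀ a ∈ Γ', ∀ b ∈ Γ, a * b = b * a)
    (ζ : Parameter Γ') (γ : Γ) :
    (D.restrict hle).variety ζ → (D.restrict hle).variety ζ :=
  Quotient.map (fun x => ⟨D.twist γ x, D.twist_mem_level hle hc ζ γ x x.2⟩) (by
    rintro x y ⟨g, hg, hxy⟩
    refine ⟨g, hg, ?_⟩
    change gauge g (D.twist γ (x : Triple V W)) = D.twist γ (y : Triple V W)
    rw [gauge_twist, hxy])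

/-- The fixed points of `Γ` on the quiver variety of the central subgroup `Γ'`. -/
def fixedPoints (hle : Γ' ≤ Γ) (hc : ∀ a ∈ Γ', ∀ b ∈ Γ, a * b = b * a)
    (ζ : Parameter Γ') : Set ((D.restrict hle).variety ζ) :=
  {p | ∀ γ : Γ, D.act hle hc ζ γ p = p}

/-- `g : Γ → U_{Γ'}(V)` is an action of `Γ` on `V` induced by the triple `x`:
`g_γ B g_γ⁻¹ = B^γ`, `g_γ i = i^γ`, `j g_γ⁻¹ = j^γ`. -/
def Induces (hle : Γ' ≤ Γ) (x : Triple V W) (g : Γ →* (D.restrict hle).gaugeGroup) : Prop :=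
  ∀ γ : Γ, gauge (g γ : unitary (V →L[ℂ] V)) x = D.twist γ x

/-- The locus of the fixed points for which the induced action of `Γ` on `V` is isomorphic to the
given representation of `Γ` on `V`. -/
def fixedLocus (hle : Γ' ≤ Γ) (hc : ∀ a ∈ Γ', ∀ b ∈ Γ, a * b = b * a)
    (ζ : Parameter Γ') : Set ((D.restrict hle).variety ζ) :=
  {p | p ∈ D.fixedPoints hle hc ζ ∧
    ∃ (x : (D.restrict hle).level ζ) (g : Γ →* (D.restrict hle).gaugeGroup),
      (D.restrict hle).point ζ x = p ∧ D.Induces hle x g ∧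
      ∃ T : V ≃ₗ[ℂ] V, ∀ (γ : Γ) (u : V),
        T (((g γ : unitary (V →L[ℂ] V)) : V →L[ℂ] V) u) = (D.rhoV γ : V →L[ℂ] V) (T u)}

/-- A triple for `Γ` and `σ^* ζ` is also a triple for `Γ'` and `ζ`. -/
theorem level_sigma_subset (hle : Γ' ≤ Γ) (hc : ∀ a ∈ Γ', ∀ b ∈ Γ, a * b = b * a)
    (ζ : Parameter Γ') : D.level (ζ.sigma hle hc) ⊆ (D.restrict hle).level ζ := by
  rintro x ⟨⟨hB, hi, hj⟩, hC, hR⟩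
  refine ⟨⟨fun γ a => hB (Subgroup.inclusion hle γ) a, fun γ => hi (Subgroup.inclusion hle γ),
    fun γ => hj (Subgroup.inclusion hle γ)⟩, ?_, ?_⟩
  · rw [hC]
    exact congrArg Neg.neg (groupAlgebraAction_mapDomain hle D.rhoV ζ.c)
  · refine hR.trans ?_
    exact congrArg Neg.neg (groupAlgebraAction_mapDomain hle D.rhoV ζ.r)

end Datum

end CentralSubgroup

end QuiverVariety

/-! The engine is freeness: for generic $\zeta$ the group $U_{\Gamma'}(V)$ acts freely on the level
set (`eq_one_of_gauge_eq`). Suppose $u\ne1$ fixes $(B,i,j)$. The orthogonal complement of the fixed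
space of $u$ is nonzero, stable under $\Gamma'$, $B$ and $B^\dagger$, and killed by $j$ and
$i^\dagger$. Take a minimal nonzero subspace $S$ of this kind, with dimension vector $\theta$. On
$S$ the equations reduce to $[B,B]=-\zeta_{\mathbb C}$ and $[B,B^\dagger]=-\zeta_{\mathbb R}$, and
traces give $\sum\zeta^k_{\mathbb C}\theta_k=\sum\zeta^k_{\mathbb R}\theta_k=0$. Moreover
${}^t\theta C\theta\le2$. By Schur's lemma the map $\xi\mapsto[B,\xi]$ from
$\mathrm{End}_{\Gamma'}(S)$ to $\mathrm{Hom}_{\Gamma'}(S\otimes L,S)$ has kernel of dimension at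
most one. Its image is isotropic for the natural symplectic form because $[B,B]$ is central, so its
rank is at most half the dimension of the target (`two_mul_card_le_sum_adjacency`). Hence $\theta$
contradicts genericity. The group $\Gamma'$ is central, hence abelian, so all this can be written in
an orthonormal basis of weight vectors.

Freeness makes the $g_\gamma$ attached to a fixed point unique. Uniqueness forces multiplicativity
and agreement with the given action on $\Gamma'$. It also makes the map of quotients injective: an
element of $U_{\Gamma'}(V)$ carrying one $\Gamma$-equivariant triple to another must commute with
$\Gamma$. For surjectivity, an isomorphism from the induced representation to $V$ is replaced by its
unitary polar part (`exists_unitary_intertwiner`), which moves the triple to a $\Gamma$-equivariant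
one. Finally, equivariance is a closed condition and the gauge group is compact, so the map is
closed and therefore a homeomorphism onto its image. -/

namespace QuiverVariety

/-! ### Dimension count for simple solutions, in matrix form. -/

section MatrixModel

variable {ι : Type*} [Fintype ι]

/-- An isotropic family of vectors in a space with a form that is nondegenerate along it spans at
most half of the dimension. -/
theorem two_mul_finrank_range_le {X H : Type*} [AddCommGroup X] [Module ℂ X] [AddCommGroup H]
    [Module ℂ H] [FiniteDimensional ℂ H] (d : X →ₗ[ℂ] H) (ω : H →ₗ[ℂ] H →ₗ[ℂ] ℂ)
    (hiso : ∀ x y, ω (d x) (d y) = 0) (hnd : ∀ x, (∀ y, ω (d x) y = 0) → d x = 0) :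
    2 * Module.finrank ℂ (LinearMap.range d) ≤ Module.finrank ℂ H := by
  set R := LinearMap.range d with hR
  have h1 := Subspace.finrank_add_finrank_dualAnnihilator_eq R
  -- Isotropy sends $R$ into its own annihilator, whose dimension is $\dim H-\dim R$; nondegeneracy
  -- makes this injective.
  let f : R →ₗ[ℂ] R.dualAnnihilator := (ω.comp R.subtype).codRestrict _ (by
    rintro ⟨_, x, rfl⟩
    rw [Submodule.mem_dualAnnihilator]
    rintro _ ⟨y, rfl⟩
    exact hiso x y)
  have hf : Function.Injective f := by
    rw [injective_iff_map_eq_zero]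
    rintro ⟨_, x, rfl⟩ hx
    refine Subtype.ext (hnd x fun y => ?_)
    exact LinearMap.congr_fun (congrArg Subtype.val hx) y
  have h2 := LinearMap.finrank_le_finrank_of_injective hf
  omega

/-- The hermitian form `∑ M_ab tr (D_a D_bᴴ)` is definite if `M` is. -/
theorem eq_zero_of_sum_trace_eq_zero {M : Matrix (Fin 2) (Fin 2) ℂ} (hM : M.PosDef)
    (D : Fin 2 → Matrix ι ι ℂ)
    (h : ∑ a, ∑ b, M a b * (D a * (D b)ᴴ).trace = 0) : D = 0 := by
  -- Entrywise this is $\sum_{k,l}y^*My$ with $y_a=\overline{D_a(k,l)}$; the conjugate appears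
  -- because $D_a$ is the unstarred factor.
  have key : ∑ a, ∑ b, M a b * (D a * (D b)ᴴ).trace =
      ∑ k, ∑ l, star (fun a => star (D a k l)) ⬝ᵥ (M *ᵥ fun a => star (D a k l)) := by
    simp only [Fin.sum_univ_two, Matrix.trace, Matrix.diag, Matrix.mul_apply,
      Matrix.conjTranspose_apply, Finset.mul_sum, ← Finset.sum_add_distrib, dotProduct,
      Matrix.mulVec, Pi.star_apply, star_star]
    refine Finset.sum_congr rfl fun k _ => Finset.sum_congr rfl fun l _ => ?_
    ring
  rw [key] at h
  have hnn : ∀ y : Fin 2 → ℂ, 0 ≤ star y ⬝ᵥ (M *ᵥ y) := fun y =>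
    hM.posSemidef.dotProduct_mulVec_nonneg y
  rw [Finset.sum_eq_zero_iff_of_nonneg fun k _ => Finset.sum_nonneg fun l _ => hnn _] at h
  funext a
  ext k l
  have h2 := h k (Finset.mem_univ _)
  rw [Finset.sum_eq_zero_iff_of_nonneg fun l _ => hnn _] at h2
  have h3 := h2 l (Finset.mem_univ _)
  by_contra hne
  have : (fun a => star (D a k l)) ≠ 0 := fun h0 => hne (by
    have := congrFun h0 a
    simpa using this)
  exact (hM.dotProduct_mulVec_pos this).ne' h3

/-- If `ξ` commutes with `B` and with the real moment map, it commutes with `B†`. -/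
theorem commute_conjTranspose {M : Matrix (Fin 2) (Fin 2) ℂ} (hM : M.PosDef)
    (B : Fin 2 → Matrix ι ι ℂ) (ξ : Matrix ι ι ℂ) (hB : ∀ a, B a * ξ = ξ * B a)
    (hR : (∑ a, ∑ b, M a b • (B a * (B b)ᴴ - (B b)ᴴ * B a)) * ξ =
      ξ * ∑ a, ∑ b, M a b • (B a * (B b)ᴴ - (B b)ᴴ * B a)) (a : Fin 2) :
    (B a)ᴴ * ξ = ξ * (B a)ᴴ := by
  -- The squared norm of $[B,\xi^\dagger]$ equals $\mathrm{tr}(\xi^\dagger[\mu,\xi])$, with $\mu$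
  -- the real bracket, and so vanishes. Taking adjoints of $[B,\xi^\dagger]=0$ gives the claim.
  have hD : (fun a => B a * ξᴴ - ξᴴ * B a) = 0 := by
    apply eq_zero_of_sum_trace_eq_zero hM
    have h1 : ∀ a b, ((B a * ξᴴ - ξᴴ * B a) * (B b * ξᴴ - ξᴴ * B b)ᴴ).trace =
        (ξᴴ * ((B a * (B b)ᴴ - (B b)ᴴ * B a) * ξ - ξ * (B a * (B b)ᴴ - (B b)ᴴ * B a))).trace := by
      intro a b
      have e1 : (B a * ξᴴ - ξᴴ * B a) * (B b * ξᴴ - ξᴴ * B b)ᴴ =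
          B a * (ξᴴ * (ξ * (B b)ᴴ - (B b)ᴴ * ξ)) - ξᴴ * B a * (ξ * (B b)ᴴ - (B b)ᴴ * ξ) := by
        simp only [Matrix.conjTranspose_sub, Matrix.conjTranspose_mul,
          Matrix.conjTranspose_conjTranspose]
        noncomm_ring
      have e2 : ξᴴ * ((B a * (B b)ᴴ - (B b)ᴴ * B a) * ξ - ξ * (B a * (B b)ᴴ - (B b)ᴴ * B a)) =
          ξᴴ * (ξ * (B b)ᴴ - (B b)ᴴ * ξ) * B a - ξᴴ * B a * (ξ * (B b)ᴴ - (B b)ᴴ * ξ) := by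
        have e3 : ξᴴ * (ξ * (B b)ᴴ - (B b)ᴴ * ξ) * B a =
            ξᴴ * (ξ * (B b)ᴴ * B a - (B b)ᴴ * (B a * ξ)) := by rw [hB]; noncomm_ring
        have e4 : ξᴴ * B a * (ξ * (B b)ᴴ - (B b)ᴴ * ξ) =
            ξᴴ * (ξ * B a * (B b)ᴴ - B a * (B b)ᴴ * ξ) := by rw [← hB]; noncomm_ring
        rw [e3, e4]
        noncomm_ring
      rw [e1, e2, Matrix.trace_sub, Matrix.trace_sub, Matrix.trace_mul_comm (B a)]
    have h2 : ∑ a, ∑ b, M a b * (ξᴴ * ((B a * (B b)ᴴ - (B b)ᴴ * B a) * ξ -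
        ξ * (B a * (B b)ᴴ - (B b)ᴴ * B a))).trace =
        (ξᴴ * ((∑ a, ∑ b, M a b • (B a * (B b)ᴴ - (B b)ᴴ * B a)) * ξ -
          ξ * ∑ a, ∑ b, M a b • (B a * (B b)ᴴ - (B b)ᴴ * B a))).trace := by
      simp only [Fin.sum_univ_two, add_mul, mul_add, mul_sub, smul_mul_assoc, mul_smul_comm,
        Matrix.trace_add, Matrix.trace_sub, Matrix.trace_smul, smul_eq_mul]
      ring
    simp only [h1, h2, hR, sub_self, mul_zero, Matrix.trace_zero]
  have h2 : B a * ξᴴ - ξᴴ * B a = 0 := congrFun hD a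
  have h3 := congrArg Matrix.conjTranspose (sub_eq_zero.mp h2)
  simpa only [Matrix.conjTranspose_mul, Matrix.conjTranspose_conjTranspose, eq_comm] using h3

variable {Γ : Subgroup SL2}

/-- The matrices of equivariant pairs `(C_0, C_1)`, in a basis of weight vectors whose weights are
given by `c`. -/
def equivariantPairs (c : ι → (Γ →* ℂˣ)) : Submodule ℂ (Fin 2 → Matrix ι ι ℂ) where
  carrier := {C | ∀ (γ : Γ) (a : Fin 2) (k l : ι),
    (c k γ : ℂ) * C a k l = (∑ b, (γ : SL2).1 b a * C b k l) * c l γ}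
  zero_mem' := by intro γ a k l; simp
  add_mem' := by
    intro C D hC hD γ a k l
    simp only [Pi.add_apply, Matrix.add_apply, mul_add, Finset.sum_add_distrib, add_mul, hC γ a k l,
      hD γ a k l]
  smul_mem' := by
    intro t C hC γ a k l
    have := hC γ a k l
    simp only [Pi.smul_apply, Matrix.smul_apply, smul_eq_mul, Fin.sum_univ_two] at this ⊢
    linear_combination t * this

theorem det_eq_one (γ : SL2) : γ.1 0 0 * γ.1 1 1 - γ.1 0 1 * γ.1 1 0 = 1 := by
  rw [← Matrix.det_fin_two]; exact γ.2

/-- The matrix $\gamma$ enters the equivariance condition transposed. Since $\det\gamma=1$, the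
symplectic form identifies $L$ with its dual, so each entry yields a vector $(C_1,-C_0)_{kl}$ of
weight $c_l$ in $c_k\otimes L$. -/
theorem finrank_equivariantPairs_le (c : ι → (Γ →* ℂˣ)) :
    Module.finrank ℂ (equivariantPairs c) ≤ ∑ k, ∑ l, adjacency (c k) (c l) := by
  let v : ∀ _ _ : ι, equivariantPairs c →ₗ[ℂ] (Fin 2 → ℂ) := fun k l =>
    { toFun := fun C => ![C.1 1 k l, -C.1 0 k l]
      map_add' := by
        intro C D
        simp only [Submodule.coe_add, Pi.add_apply, Matrix.add_apply, neg_add, Matrix.cons_add_cons,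
          Matrix.empty_add_empty]
      map_smul' := by
        intro t C
        simp only [Submodule.coe_smul, Pi.smul_apply, Matrix.smul_apply, ← smul_neg,
          Matrix.smul_cons, Matrix.smul_empty, RingHom.id_apply] }
  have hv : ∀ k l C, v k l C ∈ weightSpace
      (fun γ : Γ => (c k γ : ℂ) • Matrix.mulVecLin (γ : SL2).1) (c l) := by
    intro k l C
    simp only [weightSpace, Submodule.mem_iInf, Module.End.mem_eigenspace_iff]
    intro γ
    have h0 := C.2 γ 0 k l
    have h1 := C.2 γ 1 k l
    have hd := det_eq_one (γ : SL2)
    simp only [Fin.sum_univ_two] at h0 h1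
    funext a
    fin_cases a
    · simp [v]
      linear_combination (γ : SL2).1 0 0 * h1 - (γ : SL2).1 0 1 * h0 +
        C.1 1 k l * (c l γ : ℂ) * hd
    · simp [v]
      linear_combination (γ : SL2).1 1 0 * h1 - (γ : SL2).1 1 1 * h0 -
        C.1 0 k l * (c l γ : ℂ) * hd
  let F := LinearMap.pi fun k => LinearMap.pi fun l => (v k l).codRestrict _ (hv k l)
  have hF : Function.Injective F := by
    intro C D h
    apply Subtype.ext
    funext a
    ext k l
    have h1 := congrArg Subtype.val (congrFun (congrFun h k) l)
    fin_cases a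
    · simpa [F, v] using congrFun h1 1
    · simpa [F, v] using congrFun h1 0
  have := LinearMap.finrank_le_finrank_of_injective hF
  rw [Module.finrank_pi_fintype] at this
  refine this.trans (Finset.sum_le_sum fun k _ => ?_)
  rw [Module.finrank_pi_fintype]
  rfl

/-- Matrices that vanish outside of the blocks on which `c` is constant. -/
noncomputable def blockMatrix {κ : Type*} (c : ι → κ) :
    ({p : ι × ι // c p.1 = c p.2} → ℂ) →ₗ[ℂ] Matrix ι ι ℂ := by
  classical
  exact
  { toFun := fun x => Matrix.of fun k l => if h : c k = c l then x ⟨(k, l), h⟩ else 0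
    map_add' := by intro x y; ext k l; by_cases h : c k = c l <;> simp [h]
    map_smul' := by intro t x; ext k l; by_cases h : c k = c l <;> simp [h] }

theorem blockMatrix_injective {κ : Type*} (c : ι → κ) : Function.Injective (blockMatrix c) := by
  intro x y h
  funext ⟨⟨k, l⟩, hkl⟩
  have := congrFun (congrFun h k) l
  simpa [blockMatrix, hkl] using this

theorem blockMatrix_apply_eq_zero {κ : Type*} (c : ι → κ) (x) (k l : ι) (h : c k ≠ c l) :
    blockMatrix c x k l = 0 := by
  simp [blockMatrix, h]

theorem mul_blockMatrix {κ : Type*} (c : ι → κ) (x) (f : κ → ℂ) (k l : ι) :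
    f (c k) * blockMatrix c x k l = f (c l) * blockMatrix c x k l := by
  by_cases h : c k = c l
  · rw [h]
  · rw [blockMatrix_apply_eq_zero c x k l h, mul_zero, mul_zero]

theorem diagonal_commute_blockMatrix [DecidableEq ι] {κ : Type*} (c : ι → κ) (x) (f : κ → ℂ) :
    Matrix.diagonal (fun k => f (c k)) * blockMatrix c x =
      blockMatrix c x * Matrix.diagonal (fun k => f (c k)) := by
  ext k l
  rw [Matrix.diagonal_mul, Matrix.mul_diagonal, mul_blockMatrix, mul_comm]

/-- Block matrices are the endomorphisms commuting with the group, so bracketing with one preserves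
equivariance. This is the infinitesimal gauge action. -/
theorem commutator_mem_equivariantPairs (c : ι → (Γ →* ℂˣ)) {B : Fin 2 → Matrix ι ι ℂ}
    (hB : B ∈ equivariantPairs c) (x) :
    (fun a => B a * blockMatrix c x - blockMatrix c x * B a) ∈ equivariantPairs c := by
  intro γ a k l
  have h1 := fun m => hB γ a k m
  have h2 := fun m => hB γ a m l
  have h3 := fun k l => mul_blockMatrix c x (fun χ => (χ γ : ℂ)) k l
  simp only [Matrix.sub_apply, Matrix.mul_apply, mul_sub, Finset.mul_sum, Fin.sum_univ_two, sub_mul,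
    Finset.sum_mul, add_mul, ← Finset.sum_sub_distrib, ← Finset.sum_add_distrib] at *
  refine Finset.sum_congr rfl fun m _ => ?_
  linear_combination blockMatrix c x m l * h1 m - blockMatrix c x k m * h2 m - B a m l * h3 k m
    + ((γ : SL2).1 0 a * B 0 k m + (γ : SL2).1 1 a * B 1 k m) * h3 m l

/-- The symplectic form `tr (C_0 D_1 - C_1 D_0)`. -/
noncomputable def pairForm : (Fin 2 → Matrix ι ι ℂ) →ₗ[ℂ] (Fin 2 → Matrix ι ι ℂ) →ₗ[ℂ] ℂ :=
  LinearMap.mk₂ ℂ (fun C D => (C 0 * D 1 - C 1 * D 0).trace)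
    (by intros; simp [add_mul]; ring) (by intros; simp [mul_sub])
    (by intros; simp [mul_add]; ring) (by intros; simp [mul_sub])

theorem pairForm_apply (C D : Fin 2 → Matrix ι ι ℂ) :
    pairForm C D = (C 0 * D 1 - C 1 * D 0).trace := rfl

/-- Values of a character of a finite group are roots of unity. -/
theorem character_mul_star {G : Type*} [Group G] [Finite G] (χ : G →* ℂˣ) (γ : G) :
    (χ γ : ℂ) * star (χ γ : ℂ) = 1 := by
  have h : ‖(χ γ : ℂ)‖ = 1 := by
    have h1 : IsOfFinOrder (((Units.coeHom ℂ).comp χ) γ) :=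
      MonoidHom.isOfFinOrder _ (isOfFinOrder_of_finite γ)
    exact h1.norm_eq_one
  rw [Complex.star_def, Complex.mul_conj, Complex.normSq_eq_norm_sq, h]
  simp

/-- The symplectic form is nondegenerate on the equivariant pairs. -/
theorem eq_zero_of_pairForm_eq_zero [Finite Γ] (c : ι → (Γ →* ℂˣ)) {h : Matrix (Fin 2) (Fin 2) ℂ}
    (hpos : h.PosDef) (hinv : ∀ γ : Γ, (γ : SL2).1ᴴ * h * (γ : SL2).1 = h)
    {D : Fin 2 → Matrix ι ι ℂ} (hD : D ∈ equivariantPairs c)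
    (h0 : ∀ C ∈ equivariantPairs c, pairForm D C = 0) : D = 0 := by
  have hM := hpos.inv
  set M := h⁻¹ with hMdef
  -- The pair $(-Z_1,Z_0)$ is a quaternionic conjugate of $D$: pairing $D$ with it gives the
  -- definite form $\sum M_{ab}\,\mathrm{tr}(D_aD_b^\dagger)$. Invariance of $h$ and $\det\gamma=1$
  -- make it equivariant.
  let Z : Fin 2 → Matrix ι ι ℂ := fun a => ∑ b, M a b • (D b)ᴴ
  have hZ : ∀ (γ : Γ) (a : Fin 2) (k l : ι),
      (∑ b, (γ : SL2).1 a b * Z b k l) * c k γ = c l γ * Z a k l := by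
    intro γ a k l
    have e : ∀ b, star (c l γ : ℂ) * star (D b l k) =
        (∑ a, star ((γ : SL2).1 a b) * star (D a l k)) * star (c k γ : ℂ) := by
      intro b
      have := congrArg star (hD γ b l k)
      simpa only [star_mul', star_sum] using this
    have hk := character_mul_star (c k) γ
    have hl := character_mul_star (c l) γ
    have e' : ∀ b, (c k γ : ℂ) * star (D b l k) =
        c l γ * ∑ a, star ((γ : SL2).1 a b) * star (D a l k) := by
      intro b
      linear_combination (c k γ : ℂ) * c l γ * e b - (c k γ : ℂ) * star (D b l k) * hl +
        c l γ * (∑ a, star ((γ : SL2).1 a b) * star (D a l k)) * hk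
    have hi := inv_invariant h γ (hinv γ)
    have hia : ∀ b, M a b = ∑ p, ∑ q, (γ : SL2).1 a p * M p q * star ((γ : SL2).1 b q) := by
      intro b
      rw [hMdef]
      conv_lhs => rw [← hi]
      simp only [Matrix.mul_apply, Matrix.conjTranspose_apply, Fin.sum_univ_two]
      ring
    have e0 := e' 0
    have e1 := e' 1
    simp only [Z, Fin.sum_univ_two, Matrix.add_apply, Matrix.smul_apply, smul_eq_mul,
      Matrix.conjTranspose_apply] at hia e0 e1 ⊢
    rw [hia 0, hia 1]
    linear_combination ((γ : SL2).1 a 0 * M 0 0 + (γ : SL2).1 a 1 * M 1 0) * e0 +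
      ((γ : SL2).1 a 0 * M 0 1 + (γ : SL2).1 a 1 * M 1 1) * e1
  have hC : ![-Z 1, Z 0] ∈ equivariantPairs c := by
    intro γ a k l
    have z0 := hZ γ 0 k l
    have z1 := hZ γ 1 k l
    have hd := det_eq_one (γ : SL2)
    simp only [Fin.sum_univ_two] at z0 z1 ⊢
    fin_cases a
    · simp
      linear_combination (γ : SL2).1 1 0 * z0 - (γ : SL2).1 0 0 * z1 + (c k γ : ℂ) * Z 1 k l * hd
    · simp
      linear_combination (γ : SL2).1 1 1 * z0 - (γ : SL2).1 0 1 * z1 - (c k γ : ℂ) * Z 0 k l * hd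
  apply eq_zero_of_sum_trace_eq_zero hM
  have h1 := h0 _ hC
  rw [pairForm_apply] at h1
  rw [← h1]
  simp only [Z, Fin.sum_univ_two, Matrix.cons_val_zero, Matrix.cons_val_one, mul_neg, sub_neg_eq_add,
    mul_add, mul_smul_comm, Matrix.trace_add, Matrix.trace_smul, smul_eq_mul]

/-- The dimension estimate for a simple solution of the moment map equations: the dimension
vector of such a solution is a root. -/
theorem two_mul_card_le_sum_adjacency [Finite Γ] [DecidableEq ι] (c : ι → (Γ →* ℂˣ))
    {h : Matrix (Fin 2) (Fin 2) ℂ} (hpos : h.PosDef)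
    (hinv : ∀ γ : Γ, (γ : SL2).1ᴴ * h * (γ : SL2).1 = h) (B : Fin 2 → Matrix ι ι ℂ)
    (hB : B ∈ equivariantPairs c) (zc zr : (Γ →* ℂˣ) → ℂ)
    (hC : B 0 * B 1 - B 1 * B 0 = Matrix.diagonal fun k => zc (c k))
    (hR : ∑ a, ∑ b, h⁻¹ a b • (B a * (B b)ᴴ - (B b)ᴴ * B a) = Matrix.diagonal fun k => zr (c k))
    (hsimple : ∀ ξ : Matrix ι ι ℂ, (∀ k l, c k ≠ c l → ξ k l = 0) →
      (∀ a, B a * ξ = ξ * B a) → (∀ a, (B a)ᴴ * ξ = ξ * (B a)ᴴ) → ∃ t : ℂ, ξ = t • 1) :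
    2 * Nat.card {p : ι × ι // c p.1 = c p.2} ≤ (∑ k, ∑ l, adjacency (c k) (c l)) + 2 := by
  classical
  -- The differential of the gauge orbit through $B$. Its source has dimension
  -- $\sum_\chi\theta_\chi^2$, where $\theta_\chi$ counts the indices of weight $\chi$.
  let d : ({p : ι × ι // c p.1 = c p.2} → ℂ) →ₗ[ℂ] equivariantPairs c :=
    { toFun := fun x => ⟨_, commutator_mem_equivariantPairs c hB x⟩
      map_add' := by
        intro x y; apply Subtype.ext; funext a
        simp [mul_add, add_mul]; abel
      map_smul' := by
        intro t x; apply Subtype.ext; funext a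
        simp [smul_sub] }
  have hd : ∀ x a, (d x).1 a = B a * blockMatrix c x - blockMatrix c x * B a := fun _ _ => rfl
  have hker : Module.finrank ℂ (LinearMap.ker d) ≤ 1 := by
    have key : ∀ x : LinearMap.ker d, ∃ t : ℂ, blockMatrix c x = t • 1 := by
      rintro ⟨x, hx⟩
      have h1 : ∀ a, B a * blockMatrix c x = blockMatrix c x * B a := by
        intro a
        rw [← sub_eq_zero, ← hd, LinearMap.mem_ker.mp hx]; rfl
      refine hsimple _ (blockMatrix_apply_eq_zero c x) h1
        (commute_conjTranspose hpos.inv B _ h1 ?_)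
      rw [hR]
      exact diagonal_commute_blockMatrix c x zr
    let T : LinearMap.ker d →ₗ[ℂ] Matrix ι ι ℂ := (blockMatrix c).comp (LinearMap.ker d).subtype
    have hT : Function.Injective T := (blockMatrix_injective c).comp Subtype.val_injective
    have hle : LinearMap.range T ≤ Submodule.span ℂ {(1 : Matrix ι ι ℂ)} := by
      rintro _ ⟨x, rfl⟩
      obtain ⟨t, ht⟩ := key x
      exact Submodule.mem_span_singleton.mpr ⟨t, ht.symm⟩
    rw [← LinearMap.finrank_range_of_inj hT]
    exact (Submodule.finrank_mono hle).trans ((finrank_span_le_card _).trans (by simp))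
  have hrn := LinearMap.finrank_range_add_finrank_ker d
  rw [Module.finrank_fintype_fun_eq_card] at hrn
  have hhalf := two_mul_finrank_range_le d
    (pairForm.domRestrict₁₂ (equivariantPairs c) (equivariantPairs c)) (by
      intro x y
      change pairForm (d x).1 (d y).1 = 0
      rw [pairForm_apply]
      simp only [hd]
      generalize hX : blockMatrix c x = X
      generalize hY : blockMatrix c y = Y
      -- Up to commutators, which are traceless, the pairing of $[B,X]$ with $[B,Y]$ is
      -- $\mathrm{tr}(X[Y,[B_0,B_1]])$. The complex equation makes $[B_0,B_1]$ scalar on each weight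
      -- space, so it commutes with $Y$.
      have e : (B 0 * X - X * B 0) * (B 1 * Y - Y * B 1) -
          (B 1 * X - X * B 1) * (B 0 * Y - Y * B 0) =
          (B 0 * (X * (B 1 * Y - Y * B 1)) - X * (B 1 * Y - Y * B 1) * B 0) -
          (B 1 * (X * (B 0 * Y - Y * B 0)) - X * (B 0 * Y - Y * B 0) * B 1) +
          X * (Y * (B 0 * B 1 - B 1 * B 0) - (B 0 * B 1 - B 1 * B 0) * Y) := by
        noncomm_ring
      have e2 : Y * (B 0 * B 1 - B 1 * B 0) - (B 0 * B 1 - B 1 * B 0) * Y = 0 := by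
        rw [hC, ← hY, diagonal_commute_blockMatrix, sub_self]
      rw [e, e2, mul_zero, add_zero, Matrix.trace_sub, Matrix.trace_sub, Matrix.trace_sub,
        Matrix.trace_mul_comm (B 0), Matrix.trace_mul_comm (B 1), sub_self, sub_self, sub_self])
    (by
      intro x hx
      apply Subtype.ext
      exact eq_zero_of_pairForm_eq_zero c hpos hinv (d x).2 fun C hC => hx ⟨C, hC⟩)
  have hle := finrank_equivariantPairs_le c
  rw [Nat.card_eq_fintype_card]
  -- The source has dimension at most rank plus one, and twice the rank is at most $\sum a_{k,l}$;
  -- doubling the possible scalar kernel produces the summand 2.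
  omega

end MatrixModel

end QuiverVariety

namespace QuiverVariety

/-! ### Weight vectors for unitary representations of a finite abelian group. -/

section WeightBasis

variable {G : Type*} [Group G] [Finite G]
variable {V : Type*} [NormedAddCommGroup V] [InnerProductSpace ℂ V] [CompleteSpace V]

theorem finite_characters (hG : ∀ a b : G, a * b = b * a) : Finite (G →* ℂˣ) := by
  let _ : CommGroup G := { ‹Group G› with mul_comm := hG }
  infer_instance

/-- Translating the sum by a character $\varphi$ with $\varphi(g)\ne1$ multiplies it by
$\varphi(g)$. -/
theorem sum_characters_eq_zero (hG : ∀ a b : G, a * b = b * a) [Fintype (G →* ℂˣ)] {g : G}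
    (hg : g ≠ 1) : ∑ χ : G →* ℂˣ, (χ g : ℂ) = 0 := by
  let _ : CommGroup G := { ‹Group G› with mul_comm := hG }
  obtain ⟨φ, hφ⟩ := CommGroup.exists_apply_ne_one_of_hasEnoughRootsOfUnity G ℂ hg
  have h1 : ∑ χ : G →* ℂˣ, (χ g : ℂ) = (φ g : ℂ) * ∑ χ : G →* ℂˣ, (χ g : ℂ) := by
    rw [Finset.mul_sum]
    refine (Fintype.sum_equiv (Equiv.mulLeft φ) _ _ fun χ => ?_).symm
    simp
  have h2 : (1 - (φ g : ℂ)) * ∑ χ : G →* ℂˣ, (χ g : ℂ) = 0 := by linear_combination h1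
  refine (mul_eq_zero.mp h2).resolve_left fun h => hφ ?_
  exact Units.ext (sub_eq_zero.mp h).symm

/-- The weight space of a unitary representation. -/
noncomputable abbrev unitaryWeightSpace (ρ : G →* unitary (V →L[ℂ] V)) (χ : G →* ℂˣ) :
    Submodule ℂ V :=
  weightSpace (fun γ => ((ρ γ : V →L[ℂ] V) : Module.End ℂ V)) χ

theorem mem_unitaryWeightSpace {ρ : G →* unitary (V →L[ℂ] V)} {χ : G →* ℂˣ} {u : V} :
    u ∈ unitaryWeightSpace ρ χ ↔ ∀ g, (ρ g : V →L[ℂ] V) u = (χ g : ℂ) • u := by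
  simp [unitaryWeightSpace, weightSpace, Submodule.mem_iInf]

theorem unitary_apply_mul (ρ : G →* unitary (V →L[ℂ] V)) (g k : G) (u : V) :
    (ρ (g * k) : V →L[ℂ] V) u = (ρ g : V →L[ℂ] V) ((ρ k : V →L[ℂ] V) u) := by
  rw [map_mul]; rfl

theorem unitary_inner (g : unitary (V →L[ℂ] V)) (u w : V) :
    inner ℂ ((g : V →L[ℂ] V) u) ((g : V →L[ℂ] V) w) = inner ℂ u w := by
  rw [← ContinuousLinearMap.adjoint_inner_right, ← ContinuousLinearMap.star_eq_adjoint]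
  change inner ℂ u ((star (g : V →L[ℂ] V) * (g : V →L[ℂ] V)) w) = _
  rw [Unitary.coe_star_mul_self]
  rfl

/-- Averaging $s\in S$ against each character projects it, up to a factor, to a weight vector still
in $S$, and these projections add up to a nonzero multiple of $s$. -/
theorem mem_iSup_weightSpace (hG : ∀ a b : G, a * b = b * a) (ρ : G →* unitary (V →L[ℂ] V))
    (S : Submodule ℂ V) (hS : ∀ g, ∀ s ∈ S, (ρ g : V →L[ℂ] V) s ∈ S) :
    S ≤ ⨆ χ, S ⊓ unitaryWeightSpace ρ χ := by
  classical
  have := finite_characters hG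
  let _ := Fintype.ofFinite (G →* ℂˣ)
  let _ := Fintype.ofFinite G
  intro s hs
  let p : (G →* ℂˣ) → V := fun χ => ∑ g, (χ g⁻¹ : ℂ) • (ρ g : V →L[ℂ] V) s
  have hp : ∀ χ, p χ ∈ S ⊓ unitaryWeightSpace ρ χ := by
    intro χ
    refine ⟨Submodule.sum_mem _ fun g _ => Submodule.smul_mem _ _ (hS g s hs), ?_⟩
    refine mem_unitaryWeightSpace.mpr fun k => ?_
    simp only [p, map_sum, map_smul, Finset.smul_sum, smul_smul]
    refine Fintype.sum_equiv (Equiv.mulLeft k) _ _ fun g => ?_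
    rw [← unitary_apply_mul]
    have hk : (χ k : ℂ) ≠ 0 := (χ k).ne_zero
    simp only [Equiv.coe_mulLeft, mul_inv_rev, map_mul, map_inv, Units.val_mul, Units.val_inv_eq_inv_val]
    congr 1
    field_simp
  have hsum : ∑ χ, p χ = (Fintype.card (G →* ℂˣ) : ℂ) • s := by
    simp only [p]
    rw [Finset.sum_comm]
    simp only [← Finset.sum_smul]
    rw [Finset.sum_eq_single 1]
    · simp
    · intro g _ hg
      rw [sum_characters_eq_zero hG (inv_ne_one.mpr hg), zero_smul]
    · simp
  -- Only $g=1$ survives in the double sum, so the normalization is the number of characters; its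
  -- equality with the group order is not needed.
  have hne : (Fintype.card (G →* ℂˣ) : ℂ) ≠ 0 := Nat.cast_ne_zero.mpr Fintype.card_ne_zero
  rw [← inv_smul_smul₀ hne s, ← hsum]
  exact Submodule.smul_mem _ _ (Submodule.sum_mem _ fun χ _ =>
    Submodule.mem_iSup_of_mem (p := fun χ => S ⊓ unitaryWeightSpace ρ χ) χ (hp χ))

/-- By unitarity a nonzero inner product forces $\overline{\chi(g)}\psi(g)=1$, and
$\overline{\chi(g)}=\chi(g)^{-1}$. -/
theorem inner_eq_zero_of_weights_ne (ρ : G →* unitary (V →L[ℂ] V)) {χ ψ : G →* ℂˣ} (h : χ ≠ ψ)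
    {u w : V} (hu : u ∈ unitaryWeightSpace ρ χ) (hw : w ∈ unitaryWeightSpace ρ ψ) :
    inner ℂ u w = 0 := by
  by_contra hne
  apply h
  ext g
  have h1 := unitary_inner (ρ g) u w
  rw [mem_unitaryWeightSpace.mp hu, mem_unitaryWeightSpace.mp hw, inner_smul_left,
    inner_smul_right, ← mul_assoc] at h1
  have h2 : star (χ g : ℂ) * (ψ g : ℂ) = 1 := mul_right_cancel₀ hne (h1.trans (one_mul _).symm)
  have h3 := character_mul_star χ g
  linear_combination (ψ g : ℂ) * h3 - (χ g : ℂ) * h2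

/-- An invariant subspace of a unitary representation of a finite abelian group has an orthonormal
basis of weight vectors. -/
theorem exists_orthonormal_weight_basis [FiniteDimensional ℂ V] (hG : ∀ a b : G, a * b = b * a)
    (ρ : G →* unitary (V →L[ℂ] V)) (S : Submodule ℂ V)
    (hS : ∀ g, ∀ s ∈ S, (ρ g : V →L[ℂ] V) s ∈ S) :
    ∃ (θ : (G →* ℂˣ) → ℕ) (v : (Σ χ, Fin (θ χ)) → V), Orthonormal ℂ v ∧
      (∀ k, v k ∈ S) ∧ (∀ k, v k ∈ unitaryWeightSpace ρ k.1) ∧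
      S ≤ Submodule.span ℂ (Set.range v) ∧
      ∀ χ, θ χ ≤ Module.finrank ℂ (unitaryWeightSpace ρ χ) := by
  let U : (G →* ℂˣ) → Submodule ℂ V := fun χ => S ⊓ unitaryWeightSpace ρ χ
  let b := fun χ => stdOrthonormalBasis ℂ (U χ)
  have hfam : OrthogonalFamily ℂ (fun χ => U χ) fun χ => (U χ).subtypeₗᵢ := by
    intro χ ψ h u w
    exact inner_eq_zero_of_weights_ne ρ h u.2.2 w.2.2
  refine ⟨fun χ => Module.finrank ℂ (U χ), fun k => (b k.1 k.2 : V),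
    hfam.orthonormal_sigma_orthonormal fun χ => (b χ).orthonormal,
    fun k => (b k.1 k.2).2.1, fun k => (b k.1 k.2).2.2, ?_,
    fun χ => Submodule.finrank_mono inf_le_right⟩
  refine (mem_iSup_weightSpace hG ρ S hS).trans (iSup_le fun χ u hu => ?_)
  have h1 := (b χ).sum_repr ⟨u, hu⟩
  have h2 : u = ∑ i, (b χ).repr ⟨u, hu⟩ i • (b χ i : V) := by
    simpa using (congrArg Subtype.val h1).symm
  rw [h2]
  exact Submodule.sum_mem _ fun i _ => Submodule.smul_mem _ _
    (Submodule.subset_span ⟨⟨χ, i⟩, rfl⟩)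

theorem groupAlgebraAction_apply_weight (ρ : G →* unitary (V →L[ℂ] V)) {χ : G →* ℂˣ} {u : V}
    (hu : u ∈ unitaryWeightSpace ρ χ) (z : MonoidAlgebra ℂ G) :
    groupAlgebraAction ρ z u = charValue z χ • u := by
  induction z using MonoidAlgebra.induction_linear with
  | zero => simp [charValue]
  | add f g hf hg =>
    simp only [charValue] at hf hg ⊢
    simp only [map_add, add_apply, hf, hg, add_smul]
  | single a r =>
    simp [groupAlgebraAction, charValue, MonoidAlgebra.lift_single, mem_unitaryWeightSpace.mp hu,
      smul_smul]

end WeightBasis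

/-! ### Passing from operators to matrices on a subspace. -/

section Compression

variable {V : Type*} [NormedAddCommGroup V] [InnerProductSpace ℂ V] [CompleteSpace V]
variable {ι : Type*} [Fintype ι]

/-- The matrix of the compression of an operator to the span of a family of vectors. -/
noncomputable def compression (v : ι → V) : (V →L[ℂ] V) →ₗ[ℂ] Matrix ι ι ℂ where
  toFun A := Matrix.of fun k l => inner ℂ (v k) (A (v l))
  map_add' A B := by ext k l; simp
  map_smul' t A := by ext k l; simp

theorem compression_apply (v : ι → V) (A : V →L[ℂ] V) (k l : ι) :
    compression v A k l = inner ℂ (v k) (A (v l)) := rfl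

theorem compression_star (v : ι → V) (A : V →L[ℂ] V) :
    compression v (star A) = (compression v A)ᴴ := by
  ext k l
  rw [Matrix.conjTranspose_apply, compression_apply, compression_apply,
    ContinuousLinearMap.star_eq_adjoint, ContinuousLinearMap.adjoint_inner_right]
  exact (inner_conj_symm _ _).symm

variable {v : ι → V} {S : Submodule ℂ V}

theorem sum_inner_smul_eq (hv : Orthonormal ℂ v) (hS : S ≤ Submodule.span ℂ (Set.range v)) {s : V}
    (hs : s ∈ S) : ∑ k, inner ℂ (v k) s • v k = s := by
  classical
  replace hs := hS hs
  clear hS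
  induction hs using Submodule.span_induction with
  | mem x hx =>
    obtain ⟨l, rfl⟩ := hx
    simp [orthonormal_iff_ite.mp hv]
  | zero => simp
  | add x y _ _ hx hy => simp only [inner_add_right, add_smul, Finset.sum_add_distrib, hx, hy]
  | smul a x _ hx => simp only [inner_smul_right, mul_smul, ← Finset.smul_sum, hx]

/-- Insert $\sum_m v_m\langle v_m,\cdot\rangle$, the identity on $S$, between the factors. Only the
right factor must send the basis into $S$. -/
theorem compression_mul (hv : Orthonormal ℂ v) (hS : S ≤ Submodule.span ℂ (Set.range v))
    (A B : V →L[ℂ] V) (hB : ∀ l, B (v l) ∈ S) :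
    compression v (A * B) = compression v A * compression v B := by
  ext k l
  rw [Matrix.mul_apply, compression_apply]
  change inner ℂ (v k) (A (B (v l))) = _
  conv_lhs => rw [← sum_inner_smul_eq hv hS (hB l)]
  rw [map_sum, inner_sum]
  refine Finset.sum_congr rfl fun m _ => ?_
  rw [map_smul, inner_smul_right, compression_apply, compression_apply, mul_comm]

theorem compression_mulVec (hv : Orthonormal ℂ v) (hS : S ≤ Submodule.span ℂ (Set.range v))
    (A : V →L[ℂ] V) (hA : ∀ l, A (v l) ∈ S) (y : ι → ℂ) :
    A (∑ l, y l • v l) = ∑ k, (compression v A *ᵥ y) k • v k := by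
  simp only [map_sum, map_smul, Matrix.mulVec, dotProduct, Finset.sum_smul]
  rw [Finset.sum_comm]
  refine Finset.sum_congr rfl fun l _ => ?_
  conv_lhs => rw [← sum_inner_smul_eq hv hS (hA l)]
  rw [Finset.smul_sum]
  refine Finset.sum_congr rfl fun k _ => ?_
  rw [smul_smul, compression_apply, mul_comm]

end Compression

end QuiverVariety

namespace QuiverVariety

variable {V W : Type*} [NormedAddCommGroup V] [InnerProductSpace ℂ V] [CompleteSpace V]
  [NormedAddCommGroup W] [InnerProductSpace ℂ W] [CompleteSpace W]

/-! ### Subobjects and freeness of the gauge action. -/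

namespace Datum

variable {Γ : Subgroup SL2}

/-- A subspace of `V` that is stable under `Γ`, `B` and `B†`, and killed by `j` and `i†`. -/
structure IsSubobject (D : Datum Γ V W) (x : Triple V W) (S : Submodule ℂ V) : Prop where
  rho_mem : ∀ γ, ∀ s ∈ S, (D.rhoV γ : V →L[ℂ] V) s ∈ S
  B_mem : ∀ a, ∀ s ∈ S, x.1 a s ∈ S
  star_B_mem : ∀ a, ∀ s ∈ S, star (x.1 a) s ∈ S
  j_eq_zero : ∀ s ∈ S, x.2.2 s = 0
  adjoint_i_eq_zero : ∀ s ∈ S, ContinuousLinearMap.adjoint x.2.1 s = 0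

theorem compression_commutator_trace {ι : Type*} [Fintype ι] {v : ι → V} {S : Submodule ℂ V}
    (hv : Orthonormal ℂ v) (hS : S ≤ Submodule.span ℂ (Set.range v)) (A B : V →L[ℂ] V)
    (hA : ∀ l, A (v l) ∈ S) (hB : ∀ l, B (v l) ∈ S) :
    (compression v (A * B - B * A)).trace = 0 := by
  rw [map_sub, compression_mul hv hS A B hB, compression_mul hv hS B A hA, Matrix.trace_sub,
    Matrix.trace_mul_comm, sub_self]

/-- Schur's lemma for a minimal subobject, in terms of matrices. -/
theorem exists_eq_smul_one [Finite Γ] {D : Datum Γ V W} {x : Triple V W} {S : Submodule ℂ V}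
    (hSub : D.IsSubobject x S)
    (hmin : ∀ T ≤ S, D.IsSubobject x T → T ≠ ⊥ → T = S) {ι : Type*} [Fintype ι] [DecidableEq ι]
    [Nonempty ι] (c : ι → (Γ →* ℂˣ)) {v : ι → V} (hv : Orthonormal ℂ v) (hvS : ∀ k, v k ∈ S)
    (hvc : ∀ k, v k ∈ unitaryWeightSpace D.rhoV (c k)) (hS : S ≤ Submodule.span ℂ (Set.range v))
    (ξ : Matrix ι ι ℂ) (hξ : ∀ k l, c k ≠ c l → ξ k l = 0)
    (hB : ∀ a, compression v (x.1 a) * ξ = ξ * compression v (x.1 a))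
    (hB' : ∀ a, (compression v (x.1 a))ᴴ * ξ = ξ * (compression v (x.1 a))ᴴ) :
    ∃ t : ℂ, ξ = t • 1 := by
  obtain ⟨t, ht⟩ := Module.End.exists_eigenvalue (Matrix.toLin' ξ)
  refine ⟨t, ?_⟩
  let f : (ι → ℂ) →ₗ[ℂ] V := Fintype.linearCombination ℂ v
  have hf : ∀ y, f y = ∑ l, y l • v l := fun y => rfl
  have hinj : Function.Injective f :=
    linearIndependent_iff_injective_fintypeLinearCombination.mp hv.linearIndependent
  let E := Module.End.eigenspace (Matrix.toLin' ξ) t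
  have hE : ∀ y, y ∈ E ↔ ξ *ᵥ y = t • y := by
    intro y
    rw [Module.End.mem_eigenspace_iff, Matrix.toLin'_apply]
  -- The eigenspace of $\xi$, viewed inside $S$, is again a subobject: $\xi$ commutes with $B$,
  -- $B^\dagger$ and the group. Minimality makes it all of $S$, so $\xi$ is scalar.
  let T := E.map f
  have hTS : T ≤ S := by
    rintro _ ⟨y, -, rfl⟩
    rw [hf]
    exact Submodule.sum_mem _ fun l _ => Submodule.smul_mem _ _ (hvS l)
  have hstable : ∀ A : V →L[ℂ] V, (∀ s ∈ S, A s ∈ S) →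
      compression v A * ξ = ξ * compression v A → ∀ s ∈ T, A s ∈ T := by
    rintro A hA hAξ _ ⟨y, hy, rfl⟩
    rw [hf, compression_mulVec hv hS A fun l => hA _ (hvS l)]
    refine ⟨compression v A *ᵥ y, ?_, rfl⟩
    have hy' : ξ *ᵥ y = t • y := (hE y).mp hy
    refine (hE _).mpr ?_
    rw [Matrix.mulVec_mulVec, ← hAξ, ← Matrix.mulVec_mulVec, hy', Matrix.mulVec_smul]
  have hT : D.IsSubobject x T := by
    refine ⟨fun γ => hstable _ (hSub.rho_mem γ) ?_, fun a => hstable _ (hSub.B_mem a) (hB a),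
      fun a => hstable _ (hSub.star_B_mem a) ?_, fun s hs => hSub.j_eq_zero s (hTS hs),
      fun s hs => hSub.adjoint_i_eq_zero s (hTS hs)⟩
    · have hdiag : compression v (D.rhoV γ : V →L[ℂ] V) =
          Matrix.diagonal fun k => (c k γ : ℂ) := by
        ext k l
        rw [compression_apply, mem_unitaryWeightSpace.mp (hvc l), inner_smul_right,
          orthonormal_iff_ite.mp hv, Matrix.diagonal_apply]
        by_cases h : k = l
        · simp [h]
        · simp [h]
      rw [hdiag]
      ext k l
      rw [Matrix.diagonal_mul, Matrix.mul_diagonal]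
      by_cases h : c k = c l
      · rw [h, mul_comm]
      · rw [hξ k l h, mul_zero, zero_mul]
    · rw [compression_star, hB']
  have hne : T ≠ ⊥ := by
    obtain ⟨y, hy, hy0⟩ := ht.exists_hasEigenvector
    rw [Submodule.ne_bot_iff]
    exact ⟨f y, ⟨y, hy, rfl⟩, fun h => hy0 (hinj (h.trans (map_zero f).symm))⟩
  have hTeq := hmin T hTS hT hne
  ext k l
  have hl : v l ∈ T := by rw [hTeq]; exact hvS l
  obtain ⟨y, hy, hyl⟩ := hl
  have h1 : y = Pi.single l 1 := hinj (by rw [hyl, hf]; simp [Pi.single_apply])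
  have h2 := congrFun ((hE y).mp hy) k
  rw [h1] at h2
  simpa [Matrix.one_apply, Pi.single_apply] using h2

theorem sum_sigma_fin_mul {κ : Type*} [Fintype κ] (θ : κ → ℕ) (f : κ → κ → ℕ) :
    ∑ k : (Σ χ, Fin (θ χ)), ∑ l : (Σ χ, Fin (θ χ)), f k.1 l.1 =
      ∑ χ, ∑ ψ, θ χ * f χ ψ * θ ψ := by
  rw [Fintype.sum_sigma]
  refine Finset.sum_congr rfl fun χ _ => ?_
  simp only [Fintype.sum_sigma, Finset.sum_const, Finset.card_univ, Fintype.card_fin, smul_eq_mul,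
    Finset.mul_sum]
  refine Finset.sum_congr rfl fun ψ _ => ?_
  ring

/-- A minimal subobject contradicts genericity. -/
theorem not_isGeneric_of_minimal_subobject [Finite Γ] [FiniteDimensional ℂ V]
    (hΓ : ∀ a b : Γ, a * b = b * a) (D : Datum Γ V W) (ζ : Parameter Γ) {x : Triple V W}
    (hx : x ∈ D.level ζ) {S : Submodule ℂ V} (hne : S ≠ ⊥) (hSub : D.IsSubobject x S)
    (hmin : ∀ T ≤ S, D.IsSubobject x T → T ≠ ⊥ → T = S) : ¬ D.IsGeneric ζ := by
  classical
  obtain ⟨⟨hBeq, -, -⟩, hC, hR⟩ := hx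
  have := finite_characters hΓ
  let _ := Fintype.ofFinite (Γ →* ℂˣ)
  obtain ⟨θ, v, hv, hvS, hvc, hS, hθ⟩ := exists_orthonormal_weight_basis hΓ D.rhoV S hSub.rho_mem
  have hnonempty : Nonempty (Σ χ, Fin (θ χ)) := by
    by_contra h
    rw [not_nonempty_iff] at h
    apply hne
    rw [Set.range_eq_empty, Submodule.span_empty] at hS
    exact le_bot_iff.mp hS
  let B : Fin 2 → Matrix (Σ χ, Fin (θ χ)) (Σ χ, Fin (θ χ)) ℂ := fun a => compression v (x.1 a)
  have hBv : ∀ a l, x.1 a (v l) ∈ S := fun a l => hSub.B_mem a _ (hvS l)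
  have hBv' : ∀ a l, star (x.1 a) (v l) ∈ S := fun a l => hSub.star_B_mem a _ (hvS l)
  have hdiag : ∀ z : MonoidAlgebra ℂ Γ, compression v (-groupAlgebraAction D.rhoV z) =
      Matrix.diagonal fun k => -charValue z k.1 := by
    intro z
    ext k l
    rw [map_neg, Matrix.neg_apply, compression_apply, groupAlgebraAction_apply_weight _ (hvc l),
      inner_smul_right, orthonormal_iff_ite.mp hv, Matrix.diagonal_apply]
    by_cases h : k = l
    · simp [h]
    · simp [h]
  have hC' : compression v (complexBracket x.1) = Matrix.diagonal fun k => -charValue ζ.c k.1 := by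
    rw [← hdiag, ← hC, map_add]
    refine (add_eq_left.mpr ?_).symm
    ext k l
    simp [compression_apply, hSub.j_eq_zero _ (hvS l)]
  have hR' : compression v (realBracket D.h x.1) =
      Matrix.diagonal fun k => -charValue ζ.r k.1 := by
    rw [← hdiag, ← hR, map_sub, map_add]
    have h1 : compression v (x.2.1 ∘L ContinuousLinearMap.adjoint x.2.1) = 0 := by
      ext k l
      simp [compression_apply, hSub.adjoint_i_eq_zero _ (hvS l)]
    have h2 : compression v (ContinuousLinearMap.adjoint x.2.2 ∘L x.2.2) = 0 := by
      ext k l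
      simp [compression_apply, hSub.j_eq_zero _ (hvS l)]
    rw [h1, h2, add_zero, sub_zero]
  have hequiv : B ∈ equivariantPairs fun k : Σ χ, Fin (θ χ) => k.1 := by
    intro γ a k l
    -- Applying the unitary $\rho(\gamma)$ to both arguments leaves the matrix entry unchanged,
    -- while equivariance and the weights of $v_k$ and $v_l$ turn it into the entrywise condition.
    have h1 : inner ℂ ((D.rhoV γ : V →L[ℂ] V) (v k))
        ((D.rhoV γ : V →L[ℂ] V) (x.1 a (v l))) = B a k l := unitary_inner _ _ _
    have h2 := congrArg (fun A : V →L[ℂ] V => A (v l)) (hBeq γ a)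
    have h3 : (D.rhoV γ : V →L[ℂ] V) (x.1 a (v l)) =
        (l.1 γ : ℂ) • ∑ b, (γ : SL2).1 b a • x.1 b (v l) := by
      refine h2.trans ?_
      simp [precompL, mem_unitaryWeightSpace.mp (hvc l)]
    rw [h3, mem_unitaryWeightSpace.mp (hvc k), inner_smul_left, inner_smul_right, inner_sum] at h1
    simp only [inner_smul_right] at h1
    have h4 := character_mul_star k.1 γ
    rw [← h1]
    simp only [B, compression_apply]
    rw [← mul_assoc, Complex.star_def] at *
    linear_combination ((l.1 γ : ℂ) * ∑ b, (γ : SL2).1 b a * inner ℂ (v k) (x.1 b (v l))) * h4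
  have hCmat : B 0 * B 1 - B 1 * B 0 = Matrix.diagonal fun k => -charValue ζ.c k.1 := by
    rw [← hC', complexBracket, map_sub, compression_mul hv hS _ _ (hBv 1),
      compression_mul hv hS _ _ (hBv 0)]
  have hRmat : ∑ a, ∑ b, D.h⁻¹ a b • (B a * (B b)ᴴ - (B b)ᴴ * B a) =
      Matrix.diagonal fun k => -charValue ζ.r k.1 := by
    rw [← hR', realBracket]
    simp only [map_sum, map_smul, map_sub]
    refine Finset.sum_congr rfl fun a _ => Finset.sum_congr rfl fun b _ => ?_
    rw [compression_mul hv hS _ _ (hBv' b), compression_mul hv hS _ _ (hBv a), compression_star]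
  have hdim := two_mul_card_le_sum_adjacency (fun k : Σ χ, Fin (θ χ) => k.1) D.h_posDef
    D.h_invariant B hequiv (fun χ => -charValue ζ.c χ) (fun χ => -charValue ζ.r χ) hCmat hRmat
    fun ξ hξ h1 h2 => exists_eq_smul_one hSub hmin _ hv hvS hvc hS ξ hξ h1 h2
  intro hgen
  have hsum : ∀ z : MonoidAlgebra ℂ Γ, (Matrix.diagonal
      fun k : Σ χ, Fin (θ χ) => -charValue z k.1).trace = 0 →
      ((Finsupp.equivFunOnFinite.symm θ).sum fun χ m => (m : ℂ) * charValue z χ) = 0 := by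
    intro z hz
    rw [Matrix.trace_diagonal, Fintype.sum_sigma] at hz
    rw [Finsupp.sum_fintype _ _ (by simp), ← neg_eq_zero, ← hz, ← Finset.sum_neg_distrib]
    refine Finset.sum_congr rfl fun χ _ => ?_
    simp
  refine hgen (Finsupp.equivFunOnFinite.symm θ) ⟨?_, ?_⟩ hθ ⟨hsum _ ?_, hsum _ ?_⟩
  · obtain ⟨χ, k⟩ := hnonempty
    intro h0
    have : θ χ = 0 := DFunLike.congr_fun h0 χ
    exact (this ▸ k).elim0
  · rw [Finsupp.sum_fintype _ _ (by simp)]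
    have h1 : ∀ χ m, ((Finsupp.equivFunOnFinite.symm θ).sum fun ψ n =>
        (m : ℤ) * cartan χ ψ * (n : ℤ)) = ∑ ψ, (m : ℤ) * cartan χ ψ * (θ ψ : ℤ) := by
      intro χ m
      rw [Finsupp.sum_fintype _ _ (by simp)]
      rfl
    simp only [h1, Finsupp.equivFunOnFinite_symm_apply_apply]
    have h2 : (Nat.card {p : (Σ χ, Fin (θ χ)) × (Σ χ, Fin (θ χ)) // p.1.1 = p.2.1}) =
        ∑ χ, ∑ ψ, θ χ * (if χ = ψ then 1 else 0) * θ ψ := by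
      rw [Nat.card_eq_fintype_card, Fintype.card_subtype, Finset.card_filter,
        Fintype.sum_prod_type]
      exact sum_sigma_fin_mul θ fun χ ψ => if χ = ψ then 1 else 0
    have h3 : ∑ k : (Σ χ, Fin (θ χ)), ∑ l : (Σ χ, Fin (θ χ)), adjacency k.1 l.1 =
        ∑ χ, ∑ ψ, θ χ * adjacency χ ψ * θ ψ := sum_sigma_fin_mul θ _
    rw [h2, h3] at hdim
    -- ${}^t\theta C\theta=2\dim\mathrm{End}_\Gamma(S)-\sum a_{\chi,\psi}\theta_\chi\theta_\psi$,
    -- the quantity bounded by `hdim`.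
    have h4 : ∑ χ, ∑ ψ, (θ χ : ℤ) * cartan χ ψ * (θ ψ : ℤ) =
        2 * ((∑ χ, ∑ ψ, θ χ * (if χ = ψ then 1 else 0) * θ ψ : ℕ) : ℤ) -
          ((∑ χ, ∑ ψ, θ χ * adjacency χ ψ * θ ψ : ℕ) : ℤ) := by
      push_cast
      simp only [Finset.mul_sum, ← Finset.sum_sub_distrib]
      refine Finset.sum_congr rfl fun χ _ => Finset.sum_congr rfl fun ψ _ => ?_
      by_cases h : χ = ψ
      · simp only [cartan, h, if_true]; ring
      · simp only [cartan, h, if_false]; ring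
    rw [h4]
    omega
  · rw [← hC', complexBracket]
    exact compression_commutator_trace hv hS _ _ (hBv 0) (hBv 1)
  · rw [← hR', realBracket]
    simp only [map_sum, map_smul, Matrix.trace_sum, Matrix.trace_smul]
    refine Finset.sum_eq_zero fun a _ => Finset.sum_eq_zero fun b _ => ?_
    rw [compression_commutator_trace hv hS _ _ (hBv a) (hBv' b), smul_zero]

/-- The orthogonal complement of the fixed space of a stabilizer of `x`. -/
theorem isSubobject_orthogonal_ker (D : Datum Γ V W) {x : Triple V W}
    {u : unitary (V →L[ℂ] V)} (hu : u ∈ D.gaugeGroup) (hux : gauge u x = x) :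
    D.IsSubobject x (LinearMap.ker ((u : V →L[ℂ] V) - 1).toLinearMap)ᗮ := by
  set K := LinearMap.ker ((u : V →L[ℂ] V) - 1).toLinearMap with hK
  have hmem : ∀ w, w ∈ K ↔ (u : V →L[ℂ] V) w = w := by
    intro w
    rw [hK, LinearMap.mem_ker]
    exact sub_eq_zero
  -- If $u$ commutes with $A^\dagger$, then $A^\dagger$ preserves the fixed space $K$, so $A$
  -- preserves its complement. Likewise the images of $i$ and $j^\dagger$ lie in $K$, so $i^\dagger$
  -- and $j$ vanish on the complement.
  have hstable : ∀ A : V →L[ℂ] V, (u : V →L[ℂ] V) * star A = star A * (u : V →L[ℂ] V) →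
      ∀ s ∈ Kᗮ, A s ∈ Kᗮ := by
    intro A hA s hs
    rw [Submodule.mem_orthogonal] at hs ⊢
    intro w hw
    rw [← ContinuousLinearMap.adjoint_inner_left, ← ContinuousLinearMap.star_eq_adjoint]
    refine hs _ ((hmem _).mpr ?_)
    have := congrArg (fun T : V →L[ℂ] V => T w) hA
    exact this.trans (congrArg (fun z => (star A : V →L[ℂ] V) z) ((hmem w).mp hw))
  have hu1 : ((u⁻¹ : unitary (V →L[ℂ] V)) : V →L[ℂ] V) * (u : V →L[ℂ] V) = 1 :=
    Unitary.coe_star_mul_self u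
  have hB : ∀ a, (u : V →L[ℂ] V) * x.1 a = x.1 a * (u : V →L[ℂ] V) := by
    intro a
    have h1 : (u : V →L[ℂ] V) * x.1 a * ((u⁻¹ : unitary (V →L[ℂ] V)) : V →L[ℂ] V) = x.1 a :=
      congrFun (congrArg Prod.fst hux) a
    conv_rhs => rw [← h1]
    rw [mul_assoc _ _ (u : V →L[ℂ] V), hu1, mul_one]
  have hi : (u : V →L[ℂ] V) ∘L x.2.1 = x.2.1 := congrArg (fun y => y.2.1) hux
  have hj : x.2.2 ∘L (u : V →L[ℂ] V) = x.2.2 := by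
    have h1 : x.2.2 ∘L ((u⁻¹ : unitary (V →L[ℂ] V)) : V →L[ℂ] V) = x.2.2 :=
      congrArg (fun y => y.2.2) hux
    conv_lhs => rw [← h1]
    rw [ContinuousLinearMap.comp_assoc]
    exact congrArg (x.2.2 ∘L ·) hu1
  have hB' : ∀ a, (u : V →L[ℂ] V) * star (x.1 a) = star (x.1 a) * (u : V →L[ℂ] V) := by
    intro a
    have h1 := congrArg star (hB a)
    rw [star_mul, star_mul] at h1
    have h2 : (u : V →L[ℂ] V) * star (u : V →L[ℂ] V) = 1 := Unitary.coe_mul_star_self u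
    have h3 : star (u : V →L[ℂ] V) * (u : V →L[ℂ] V) = 1 := Unitary.coe_star_mul_self u
    calc (u : V →L[ℂ] V) * star (x.1 a)
        = (u : V →L[ℂ] V) * (star (x.1 a) * star (u : V →L[ℂ] V)) * (u : V →L[ℂ] V) := by
          rw [mul_assoc, mul_assoc, h3, mul_one]
      _ = star (x.1 a) * (u : V →L[ℂ] V) := by rw [h1, ← mul_assoc, h2, one_mul]
  refine ⟨fun γ => hstable _ ?_, fun a => hstable _ (hB' a), fun a => hstable _ ?_, ?_, ?_⟩
  · have h1 : D.rhoV γ⁻¹ * u = u * D.rhoV γ⁻¹ :=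
      Subgroup.mem_centralizer_iff.mp hu _ ⟨γ⁻¹, rfl⟩
    rw [map_inv] at h1
    exact (congrArg Subtype.val h1).symm
  · rw [star_star]
    exact hB a
  · intro s hs
    rw [← inner_self_eq_zero (𝕜 := ℂ), ← ContinuousLinearMap.adjoint_inner_left]
    refine (Submodule.mem_orthogonal _ _).mp hs _ ((hmem _).mpr ?_)
    have h1 : ContinuousLinearMap.adjoint (u : V →L[ℂ] V) ∘L ContinuousLinearMap.adjoint x.2.2 =
        ContinuousLinearMap.adjoint x.2.2 := by
      rw [← ContinuousLinearMap.adjoint_comp, hj]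
    have h2 : (u : V →L[ℂ] V) ∘L ContinuousLinearMap.adjoint x.2.2 =
        ContinuousLinearMap.adjoint x.2.2 := by
      conv_lhs => rw [← h1]
      rw [← ContinuousLinearMap.comp_assoc]
      exact congrArg (· ∘L ContinuousLinearMap.adjoint x.2.2) (Unitary.coe_mul_star_self u)
    exact congrArg (fun T : W →L[ℂ] V => T (x.2.2 s)) h2
  · intro s hs
    rw [← inner_self_eq_zero (𝕜 := ℂ), ContinuousLinearMap.adjoint_inner_right]
    refine (Submodule.mem_orthogonal _ _).mp hs _ ((hmem _).mpr ?_)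
    exact congrArg (fun T : W →L[ℂ] V => T (ContinuousLinearMap.adjoint x.2.1 s)) hi

/-- For a generic parameter, the unitary gauge group acts freely on the level set. -/
theorem eq_one_of_gauge_eq [Finite Γ] [FiniteDimensional ℂ V] (hΓ : ∀ a b : Γ, a * b = b * a)
    (D : Datum Γ V W) (ζ : Parameter Γ) (hζ : D.IsGeneric ζ) {x : Triple V W} (hx : x ∈ D.level ζ)
    {u : unitary (V →L[ℂ] V)} (hu : u ∈ D.gaugeGroup) (hux : gauge u x = x) : u = 1 := by
  by_contra hne
  set K := LinearMap.ker ((u : V →L[ℂ] V) - 1).toLinearMap with hK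
  have hKne : Kᗮ ≠ ⊥ := by
    intro h
    rw [Submodule.orthogonal_eq_bot_iff] at h
    apply hne
    ext w
    have : w ∈ K := by rw [h]; trivial
    exact sub_eq_zero.mp (LinearMap.mem_ker.mp this)
  obtain ⟨S, ⟨hS, hSne⟩, hmin⟩ := wellFounded_lt.has_min
    {S : Submodule ℂ V | D.IsSubobject x S ∧ S ≠ ⊥}
    ⟨_, D.isSubobject_orthogonal_ker hu hux, hKne⟩
  refine D.not_isGeneric_of_minimal_subobject hΓ ζ hx hSne hS (fun T hTS hT hTne => ?_) hζ
  by_contra h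
  exact hmin T ⟨hT, hTne⟩ (lt_of_le_of_ne hTS h)

end Datum

end QuiverVariety

/-! ### Unitary intertwiners, compactness and continuity. -/

namespace QuiverVariety

variable {V W : Type*} [NormedAddCommGroup V] [InnerProductSpace ℂ V] [CompleteSpace V]
  [NormedAddCommGroup W] [InnerProductSpace ℂ W] [CompleteSpace W]

/-- Isomorphic unitary representations are unitarily isomorphic: the unitary part of the polar
decomposition of an intertwiner is an intertwiner. -/
theorem exists_unitary_intertwiner {ι : Type*} (g ρ : ι → unitary (V →L[ℂ] V))
    (T : (V →L[ℂ] V)ˣ)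
    (hT : ∀ γ, (T : V →L[ℂ] V) * (g γ : V →L[ℂ] V) = (ρ γ : V →L[ℂ] V) * (T : V →L[ℂ] V)) :
    ∃ U : unitary (V →L[ℂ] V), ∀ γ, U * g γ = ρ γ * U := by
  -- $T^*T$ commutes with every $g_\gamma$ because both representations are unitary; the functional
  -- calculus passes this to its square root $|T|$. Then $T|T|^{-1}$ is the desired intertwiner.
  have hcomm : ∀ γ, Commute (CFC.abs (T : V →L[ℂ] V)) (g γ : V →L[ℂ] V) := by
    intro γ
    refine Commute.cfcₙ_nnreal ?_ _
    have h1 : (star (ρ γ : V →L[ℂ] V)) * T = T * star (g γ : V →L[ℂ] V) := by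
      calc (star (ρ γ : V →L[ℂ] V)) * T
          = star (ρ γ : V →L[ℂ] V) * (T * (g γ : V →L[ℂ] V)) * star (g γ : V →L[ℂ] V) := by
            have h0 : (g γ : V →L[ℂ] V) * star (g γ : V →L[ℂ] V) = 1 := Unitary.coe_mul_star_self _
            rw [mul_assoc, mul_assoc, h0, mul_one]
        _ = T * star (g γ : V →L[ℂ] V) := by
            rw [hT, ← mul_assoc, Unitary.coe_star_mul_self, one_mul]
    have h2 := congrArg star h1
    rw [star_mul, star_mul, star_star, star_star] at h2
    change star (T : V →L[ℂ] V) * T * (g γ : V →L[ℂ] V) = (g γ : V →L[ℂ] V) * (star (T : V →L[ℂ] V) * T)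
    rw [mul_assoc, hT, ← mul_assoc, h2, mul_assoc]
  have hsq := CFC.abs_mul_abs (T : V →L[ℂ] V)
  have hsa : star (CFC.abs (T : V →L[ℂ] V)) = CFC.abs (T : V →L[ℂ] V) :=
    (CFC.abs_nonneg (T : V →L[ℂ] V)).isSelfAdjoint
  have hunit : IsUnit (CFC.abs (T : V →L[ℂ] V)) := by
    have h : IsUnit (CFC.abs (T : V →L[ℂ] V) * CFC.abs (T : V →L[ℂ] V)) := by
      rw [hsq]
      exact T.isUnit.star.mul T.isUnit
    exact ((Commute.refl _).isUnit_mul_iff.mp h).1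
  obtain ⟨P, hP⟩ := hunit
  rw [← hP] at hsq hsa hcomm
  have hsaP : star P = P := Units.ext hsa
  have hTP : star T * T = P * P := Units.ext hsq.symm
  let U : (V →L[ℂ] V)ˣ := T * P⁻¹
  have hU : star U * U = 1 := by
    simp only [U, star_mul, star_inv, hsaP]
    rw [mul_assoc, ← mul_assoc (star T), hTP]
    group
  have hU' : U * star U = 1 := mul_eq_one_comm.mp hU
  refine ⟨⟨(U : V →L[ℂ] V), Unitary.mem_iff.mpr ⟨congrArg Units.val hU, congrArg Units.val hU'⟩⟩,
    fun γ => Subtype.ext ?_⟩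
  change ((T * P⁻¹ : (V →L[ℂ] V)ˣ) : V →L[ℂ] V) * (g γ : V →L[ℂ] V) =
    (ρ γ : V →L[ℂ] V) * ((T * P⁻¹ : (V →L[ℂ] V)ˣ) : V →L[ℂ] V)
  have h3 : ((P⁻¹ : (V →L[ℂ] V)ˣ) : V →L[ℂ] V) * (g γ : V →L[ℂ] V) =
      (g γ : V →L[ℂ] V) * ((P⁻¹ : (V →L[ℂ] V)ˣ) : V →L[ℂ] V) := (hcomm γ).units_inv_left
  rw [Units.val_mul, mul_assoc, h3, ← mul_assoc, hT, mul_assoc]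

instance compactSpace_unitary [FiniteDimensional ℂ V] : CompactSpace (unitary (V →L[ℂ] V)) := by
  have : ProperSpace (V →L[ℂ] V) := FiniteDimensional.proper ℂ _
  refine isCompact_iff_compactSpace.mp
    (Metric.isCompact_of_isClosed_isBounded isClosed_unitary ?_)
  refine (Metric.isBounded_closedBall (x := (0 : V →L[ℂ] V)) (r := 1)).subset fun u hu => ?_
  rw [mem_closedBall_zero_iff]
  refine ContinuousLinearMap.opNorm_le_bound _ zero_le_one fun w => ?_
  rw [one_mul]
  refine le_of_eq ?_
  rw [@norm_eq_sqrt_re_inner ℂ, @norm_eq_sqrt_re_inner ℂ, unitary_inner ⟨u, hu⟩]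

theorem continuous_gauge :
    Continuous fun p : unitary (V →L[ℂ] V) × Triple V W => gauge p.1 p.2 := by
  have h1 : Continuous fun p : unitary (V →L[ℂ] V) × Triple V W => (p.1 : V →L[ℂ] V) :=
    continuous_subtype_val.comp continuous_fst
  have h2 : Continuous fun p : unitary (V →L[ℂ] V) × Triple V W =>
      ((p.1⁻¹ : unitary (V →L[ℂ] V)) : V →L[ℂ] V) := h1.star
  have h3 : Continuous fun p : unitary (V →L[ℂ] V) × Triple V W => p.2.2.1 := by fun_prop
  have h4 : Continuous fun p : unitary (V →L[ℂ] V) × Triple V W => p.2.2.2 := by fun_prop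
  have h5 : ∀ a, Continuous fun p : unitary (V →L[ℂ] V) × Triple V W => p.2.1 a := by
    intro a; fun_prop
  exact (continuous_pi fun a => (h1.mul (h5 a)).mul h2).prodMk
    ((h1.clm_comp h3).prodMk (h4.clm_comp h2))

theorem continuous_precompL (γ : SL2) : Continuous (precompL γ : (Fin 2 → V →L[ℂ] V) → _) := by
  refine continuous_pi fun a => ?_
  unfold precompL
  fun_prop

/-! ### Topology of the level set and of its quotient. -/

namespace Datum

variable {Γ Γ' : Subgroup SL2}

theorem continuous_twist (D : Datum Γ V W) (γ : Γ) : Continuous (D.twist γ) := by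
  have h3 : Continuous fun p : Triple V W => p.2.1 := by fun_prop
  have h4 : Continuous fun p : Triple V W => p.2.2 := by fun_prop
  exact ((continuous_precompL _).comp continuous_fst).prodMk
    ((h3.clm_comp continuous_const).prodMk (continuous_const.clm_comp h4))

theorem twist_mul (D : Datum Γ V W) (γ δ : Γ) (x : Triple V W) :
    D.twist (γ * δ) x = D.twist δ (D.twist γ x) := by
  refine Prod.ext ?_ (Prod.ext ?_ ?_)
  · exact precompL_mul (γ : SL2) δ x.1
  · ext; simp [twist]
  · ext; simp [twist]

/-- A triple is equivariant if and only if the given representation of `Γ` on `V` is an action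
induced by the triple. -/
theorem isEquivariant_iff (D : Datum Γ V W) (x : Triple V W) :
    D.IsEquivariant x ↔ ∀ γ, gauge (D.rhoV γ) x = D.twist γ x := by
  have hV : ∀ γ, (D.rhoV γ : V →L[ℂ] V) *
      (((D.rhoV γ)⁻¹ : unitary (V →L[ℂ] V)) : V →L[ℂ] V) = 1 := fun γ =>
    Unitary.coe_mul_star_self _
  have hV' : ∀ γ, (((D.rhoV γ)⁻¹ : unitary (V →L[ℂ] V)) : V →L[ℂ] V) *
      (D.rhoV γ : V →L[ℂ] V) = 1 := fun γ => Unitary.coe_star_mul_self _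
  have hW : ∀ γ, (D.rhoW γ : W →L[ℂ] W) * (D.rhoW γ⁻¹ : W →L[ℂ] W) = 1 := by
    intro γ
    rw [map_inv]
    exact Unitary.coe_mul_star_self _
  have hW' : ∀ γ, (D.rhoW γ⁻¹ : W →L[ℂ] W) * (D.rhoW γ : W →L[ℂ] W) = 1 := by
    intro γ
    rw [map_inv]
    exact Unitary.coe_star_mul_self _
  constructor
  · rintro ⟨hB, hi, hj⟩ γ
    refine Prod.ext (funext fun a => ?_) (Prod.ext (hi γ) ?_)
    · change _ * _ * _ = precompL (γ : SL2) x.1 a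
      rw [hB, mul_assoc, hV, mul_one]
    · change x.2.2 ∘L _ = _ ∘L x.2.2
      have h1 : (D.rhoW γ⁻¹ : W →L[ℂ] W) ∘L ((D.rhoW γ : W →L[ℂ] W) ∘L x.2.2) = x.2.2 :=
        congrArg (· ∘L x.2.2) (hW' γ)
      conv_lhs => rw [← h1, hj γ]
      exact congrArg (fun A => (D.rhoW γ⁻¹ : W →L[ℂ] W) ∘L (x.2.2 ∘L A)) (hV γ)
  · intro h
    refine ⟨fun γ a => ?_, fun γ => congrArg (fun y => y.2.1) (h γ), fun γ => ?_⟩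
    · have h1 : _ * _ * _ = precompL (γ : SL2) x.1 a := congrFun (congrArg Prod.fst (h γ)) a
      rw [← h1, mul_assoc _ _ (D.rhoV γ : V →L[ℂ] V), hV', mul_one]
    · have h1 : x.2.2 ∘L _ = _ ∘L x.2.2 := congrArg (fun y => y.2.2) (h γ)
      have h2 : x.2.2 = ((D.rhoW γ⁻¹ : W →L[ℂ] W) ∘L x.2.2) ∘L (D.rhoV γ : V →L[ℂ] V) := by
        rw [← h1]
        exact (congrArg (x.2.2 ∘L ·) (hV' γ)).symm
      conv_lhs => rw [h2]
      exact congrArg (fun A => A ∘L (x.2.2 ∘L (D.rhoV γ : V →L[ℂ] V))) (hW γ)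

theorem isClosed_isEquivariant (D : Datum Γ V W) : IsClosed {x | D.IsEquivariant x} := by
  simp only [isEquivariant_iff, Set.ofPred_forall]
  exact isClosed_iInter fun γ => isClosed_eq
    (continuous_gauge.comp (continuous_const.prodMk continuous_id)) (D.continuous_twist γ)

theorem gauge_commute {D : Datum Γ V W} {g : unitary (V →L[ℂ] V)} (hg : g ∈ D.gaugeGroup)
    (γ : Γ) : D.rhoV γ * g = g * D.rhoV γ :=
  Subgroup.mem_centralizer_iff.mp hg _ ⟨γ, rfl⟩

theorem groupAlgebraAction_commute {D : Datum Γ V W} {g : unitary (V →L[ℂ] V)}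
    (hg : g ∈ D.gaugeGroup) (z : MonoidAlgebra ℂ Γ) :
    (g : V →L[ℂ] V) * groupAlgebraAction D.rhoV z =
      groupAlgebraAction D.rhoV z * (g : V →L[ℂ] V) := by
  induction z using MonoidAlgebra.induction_linear with
  | zero => simp
  | add f k hf hk => simp only [map_add, mul_add, add_mul, hf, hk]
  | single a r =>
    have h := congrArg Subtype.val (gauge_commute hg a)
    simp only [groupAlgebraAction, MonoidAlgebra.lift_single, mul_smul_comm, smul_mul_assoc]
    exact congrArg (r • ·) h.symm

/-- The gauge group preserves the level set. -/
theorem gauge_mem_level (D : Datum Γ V W) (ζ : Parameter Γ) {g : unitary (V →L[ℂ] V)}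
    (hg : g ∈ D.gaugeGroup) {x : Triple V W} (hx : x ∈ D.level ζ) : gauge g x ∈ D.level ζ := by
  obtain ⟨heq, hC, hR⟩ := hx
  have h1 : ((g⁻¹ : unitary (V →L[ℂ] V)) : V →L[ℂ] V) * (g : V →L[ℂ] V) = 1 :=
    Unitary.coe_star_mul_self g
  have h2 : (g : V →L[ℂ] V) * ((g⁻¹ : unitary (V →L[ℂ] V)) : V →L[ℂ] V) = 1 :=
    Unitary.coe_mul_star_self g
  have hs : star (g : V →L[ℂ] V) = ((g⁻¹ : unitary (V →L[ℂ] V)) : V →L[ℂ] V) := rfl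
  have hs' : star ((g⁻¹ : unitary (V →L[ℂ] V)) : V →L[ℂ] V) = (g : V →L[ℂ] V) := star_star _
  have hconj : ∀ z, (g : V →L[ℂ] V) * -groupAlgebraAction D.rhoV z *
      ((g⁻¹ : unitary (V →L[ℂ] V)) : V →L[ℂ] V) = -groupAlgebraAction D.rhoV z := by
    intro z
    rw [mul_neg, groupAlgebraAction_commute hg, neg_mul, mul_assoc, h2, mul_one]
  have hmul : ∀ A B : V →L[ℂ] V, (g : V →L[ℂ] V) * A * ((g⁻¹ : unitary (V →L[ℂ] V)) : V →L[ℂ] V) *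
      ((g : V →L[ℂ] V) * B * ((g⁻¹ : unitary (V →L[ℂ] V)) : V →L[ℂ] V)) =
      (g : V →L[ℂ] V) * (A * B) * ((g⁻¹ : unitary (V →L[ℂ] V)) : V →L[ℂ] V) := by
    intro A B
    rw [mul_assoc _ _ ((g : V →L[ℂ] V) * B * _), mul_assoc (g : V →L[ℂ] V) B,
      ← mul_assoc _ (g : V →L[ℂ] V) (B * _), h1, one_mul]
    simp only [mul_assoc]
  refine ⟨?_, ?_, ?_⟩
  · rw [isEquivariant_iff] at heq ⊢
    intro γ
    rw [← gauge_mul, gauge_commute hg, gauge_mul, heq, gauge_twist]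
  · rw [← hconj, ← hC]
    have e2 : ((g : V →L[ℂ] V) ∘L x.2.1) ∘L (x.2.2 ∘L
        ((g⁻¹ : unitary (V →L[ℂ] V)) : V →L[ℂ] V)) =
        (g : V →L[ℂ] V) * (x.2.1 ∘L x.2.2) * ((g⁻¹ : unitary (V →L[ℂ] V)) : V →L[ℂ] V) := rfl
    change complexBracket (gauge g x).1 + ((g : V →L[ℂ] V) ∘L x.2.1) ∘L (x.2.2 ∘L
        ((g⁻¹ : unitary (V →L[ℂ] V)) : V →L[ℂ] V)) = _
    rw [e2, mul_add, add_mul]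
    congr 1
    simp only [complexBracket, gauge, hmul, mul_sub, sub_mul]
  · rw [← hconj, ← hR]
    have e2 : ((g : V →L[ℂ] V) ∘L x.2.1) ∘L
        ContinuousLinearMap.adjoint ((g : V →L[ℂ] V) ∘L x.2.1) =
        (g : V →L[ℂ] V) * (x.2.1 ∘L ContinuousLinearMap.adjoint x.2.1) *
          ((g⁻¹ : unitary (V →L[ℂ] V)) : V →L[ℂ] V) := by
      rw [ContinuousLinearMap.adjoint_comp]; rfl
    have e3 : ContinuousLinearMap.adjoint
          (x.2.2 ∘L ((g⁻¹ : unitary (V →L[ℂ] V)) : V →L[ℂ] V)) ∘L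
          (x.2.2 ∘L ((g⁻¹ : unitary (V →L[ℂ] V)) : V →L[ℂ] V)) =
        (g : V →L[ℂ] V) * (ContinuousLinearMap.adjoint x.2.2 ∘L x.2.2) *
          ((g⁻¹ : unitary (V →L[ℂ] V)) : V →L[ℂ] V) := by
      rw [ContinuousLinearMap.adjoint_comp, ← ContinuousLinearMap.star_eq_adjoint, hs']; rfl
    have e1 : realBracket D.h (gauge g x).1 = (g : V →L[ℂ] V) * realBracket D.h x.1 *
        ((g⁻¹ : unitary (V →L[ℂ] V)) : V →L[ℂ] V) := by
      have hstar : ∀ a, star ((gauge g x).1 a) = (g : V →L[ℂ] V) * star (x.1 a) *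
          ((g⁻¹ : unitary (V →L[ℂ] V)) : V →L[ℂ] V) := by
        intro a
        simp only [gauge, star_mul, hs, hs', mul_assoc]
      simp only [realBracket, hstar]
      simp only [gauge, hmul, Fin.sum_univ_two, mul_add, add_mul, mul_sub, sub_mul, mul_smul_comm,
        smul_mul_assoc]
    change realBracket D.h (gauge g x).1 + ((g : V →L[ℂ] V) ∘L x.2.1) ∘L
        ContinuousLinearMap.adjoint ((g : V →L[ℂ] V) ∘L x.2.1) -
        ContinuousLinearMap.adjoint
          (x.2.2 ∘L ((g⁻¹ : unitary (V →L[ℂ] V)) : V →L[ℂ] V)) ∘L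
          (x.2.2 ∘L ((g⁻¹ : unitary (V →L[ℂ] V)) : V →L[ℂ] V)) = _
    rw [e1, e2, e3, mul_sub, sub_mul, mul_add, add_mul]

theorem point_eq_iff (D : Datum Γ V W) (ζ : Parameter Γ) (x y : D.level ζ) :
    D.point ζ x = D.point ζ y ↔ ∃ g ∈ D.gaugeGroup, gauge g (x : Triple V W) = y :=
  Quotient.eq

theorem continuous_point (D : Datum Γ V W) (ζ : Parameter Γ) : Continuous (D.point ζ) :=
  continuous_quotient_mk'

/-- The quotient map onto the quiver variety is closed, since the gauge group is compact. -/
theorem isClosedMap_point [FiniteDimensional ℂ V] (D : Datum Γ V W) (ζ : Parameter Γ) :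
    IsClosedMap (D.point ζ) := by
  intro F hF
  have hcl : IsClosed (D.gaugeGroup : Set (unitary (V →L[ℂ] V))) := by
    have : (D.gaugeGroup : Set (unitary (V →L[ℂ] V))) =
        ⋂ γ, {g | D.rhoV γ * g = g * D.rhoV γ} := by
      ext g
      simp only [Set.mem_iInter, Set.mem_ofPred_eq]
      exact ⟨fun hg γ => gauge_commute hg γ, fun h => Subgroup.mem_centralizer_iff.mpr (by
        rintro _ ⟨γ, rfl⟩
        exact h γ)⟩
    rw [this]
    exact isClosed_iInter fun γ => isClosed_eq (by fun_prop) (by fun_prop)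
  have : CompactSpace D.gaugeGroup := isCompact_iff_compactSpace.mp hcl.isCompact
  have hq : Topology.IsQuotientMap (D.point ζ) := isQuotientMap_quotient_mk'
  rw [← hq.isClosed_preimage]
  let a : D.gaugeGroup × D.level ζ → D.level ζ := fun p =>
    ⟨gauge p.1 p.2, D.gauge_mem_level ζ p.1.2 p.2.2⟩
  have ha : Continuous a := by
    refine Continuous.subtype_mk ?_ _
    exact continuous_gauge.comp ((continuous_subtype_val.comp continuous_fst).prodMk
      (continuous_subtype_val.comp continuous_snd))
  -- The saturation of $F$ is the projection of a closed set along the compact gauge group, hence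
  -- closed.
  have heq : D.point ζ ⁻¹' (D.point ζ '' F) = Prod.snd '' (a ⁻¹' F) := by
    ext y
    constructor
    · rintro ⟨z, hz, hzy⟩
      obtain ⟨g, hg, hgz⟩ := (D.point_eq_iff ζ y z).mp hzy.symm
      refine ⟨⟨⟨g, hg⟩, y⟩, ?_, rfl⟩
      have : a ⟨⟨g, hg⟩, y⟩ = z := Subtype.ext hgz
      rw [Set.mem_preimage, this]
      exact hz
    · rintro ⟨⟨g, y⟩, hy, rfl⟩
      exact ⟨_, hy, ((D.point_eq_iff ζ _ _).mpr ⟨g, g.2, rfl⟩).symm⟩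
  rw [heq]
  exact isClosedMap_snd_of_compactSpace _ (hF.preimage ha)

/-! ### From $\Gamma$ to the central subgroup: fixed points and the comparison map. -/

section CentralSubgroup

variable (D : Datum Γ V W)

theorem gaugeGroup_le_restrict (hle : Γ' ≤ Γ) : D.gaugeGroup ≤ (D.restrict hle).gaugeGroup := by
  refine Subgroup.centralizer_le ?_
  rintro _ ⟨γ, rfl⟩
  exact ⟨Subgroup.inclusion hle γ, rfl⟩

theorem rhoV_mem_gaugeGroup (hle : Γ' ≤ Γ) (hc : ∀ a ∈ Γ', ∀ b ∈ Γ, a * b = b * a) (γ : Γ) :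
    D.rhoV γ ∈ (D.restrict hle).gaugeGroup := by
  refine Subgroup.mem_centralizer_iff.mpr ?_
  rintro _ ⟨δ, rfl⟩
  change D.rhoV (Subgroup.inclusion hle δ) * D.rhoV γ = D.rhoV γ * D.rhoV (Subgroup.inclusion hle δ)
  rw [← map_mul, ← map_mul]
  exact congrArg D.rhoV (Subtype.ext (hc δ δ.2 γ γ.2))

/-- The gauge group element relating two points of the level set is unique. -/
theorem gauge_injective [Finite Γ] [FiniteDimensional ℂ V] (hΓ : ∀ a b : Γ, a * b = b * a)
    (ζ : Parameter Γ) (hζ : D.IsGeneric ζ) {x : Triple V W} (hx : x ∈ D.level ζ)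
    {u w : unitary (V →L[ℂ] V)} (hu : u ∈ D.gaugeGroup) (hw : w ∈ D.gaugeGroup)
    (h : gauge u x = gauge w x) : u = w := by
  have h1 : w⁻¹ * u = 1 := D.eq_one_of_gauge_eq hΓ ζ hζ hx
    (D.gaugeGroup.mul_mem (D.gaugeGroup.inv_mem hw) hu) (by
      rw [gauge_mul, h, ← gauge_mul, inv_mul_cancel, gauge_one])
  exact (inv_mul_eq_one.mp h1).symm

theorem mem_level_sigma_iff (hle : Γ' ≤ Γ) (hc : ∀ a ∈ Γ', ∀ b ∈ Γ, a * b = b * a)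
    (ζ : Parameter Γ') (x : Triple V W) :
    x ∈ D.level (ζ.sigma hle hc) ↔ x ∈ (D.restrict hle).level ζ ∧ D.IsEquivariant x := by
  refine ⟨fun hx => ⟨D.level_sigma_subset hle hc ζ hx, hx.1⟩, fun ⟨hx, heq⟩ => ⟨heq, ?_, ?_⟩⟩
  · rw [hx.2.1]
    exact (congrArg Neg.neg (groupAlgebraAction_mapDomain hle D.rhoV ζ.c)).symm
  · refine hx.2.2.trans ?_
    exact (congrArg Neg.neg (groupAlgebraAction_mapDomain hle D.rhoV ζ.r)).symm

variable [Finite Γ] [FiniteDimensional ℂ V]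

theorem finite_of_le (hle : Γ' ≤ Γ) : Finite Γ' :=
  Finite.of_injective _ (Subgroup.inclusion_injective hle)

theorem gauge_injective_of_central (hle : Γ' ≤ Γ) (hc : ∀ a ∈ Γ', ∀ b ∈ Γ, a * b = b * a)
    (ζ : Parameter Γ') (hζ : (D.restrict hle).IsGeneric ζ) {x : Triple V W}
    (hx : x ∈ (D.restrict hle).level ζ) {u w : unitary (V →L[ℂ] V)}
    (hu : u ∈ (D.restrict hle).gaugeGroup) (hw : w ∈ (D.restrict hle).gaugeGroup)
    (h : gauge u x = gauge w x) : u = w := by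
  have : Finite Γ' := finite_of_le hle
  exact (D.restrict hle).gauge_injective (fun a b => Subtype.ext (hc a a.2 b (hle b.2))) ζ hζ hx
    hu hw h

/-- Any action induced by a triple in the level set extends the given representation of `Γ'`. -/
theorem Induces.eq_rhoV {D : Datum Γ V W} {hle : Γ' ≤ Γ} {x : Triple V W}
    {g : Γ →* (D.restrict hle).gaugeGroup}
    (h : D.Induces hle x g) (hc : ∀ a ∈ Γ', ∀ b ∈ Γ, a * b = b * a)
    (ζ : Parameter Γ') (hζ : (D.restrict hle).IsGeneric ζ)
    (hx : x ∈ (D.restrict hle).level ζ) (γ : Γ') :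
    (g (Subgroup.inclusion hle γ) : unitary (V →L[ℂ] V)) = (D.restrict hle).rhoV γ := by
  refine D.gauge_injective_of_central hle hc ζ hζ hx (g _).2
    (D.rhoV_mem_gaugeGroup hle hc (Subgroup.inclusion hle γ)) ?_
  rw [h]
  exact (((D.restrict hle).isEquivariant_iff x).mp hx.1 γ).symm

/-- A triple representing a fixed point induces an action of `Γ`. -/
theorem exists_induces (hle : Γ' ≤ Γ) (hc : ∀ a ∈ Γ', ∀ b ∈ Γ, a * b = b * a)
    (ζ : Parameter Γ') (hζ : (D.restrict hle).IsGeneric ζ) (x : (D.restrict hle).level ζ)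
    (hx : (D.restrict hle).point ζ x ∈ D.fixedPoints hle hc ζ) :
    ∃ g : Γ →* (D.restrict hle).gaugeGroup, D.Induces hle x g := by
  have hex : ∀ γ : Γ, ∃ g : (D.restrict hle).gaugeGroup,
      gauge (g : unitary (V →L[ℂ] V)) (x : Triple V W) = D.twist γ x := by
    intro γ
    obtain ⟨g, hg, h⟩ := ((D.restrict hle).point_eq_iff ζ
      x ⟨D.twist γ x, D.twist_mem_level hle hc ζ γ x x.2⟩).mp (hx γ).symm
    exact ⟨⟨g, hg⟩, h⟩
  choose g hg using hex
  -- Twisting is a right action, but it commutes with gauge transformations: $g_\gamma g_\delta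
  -- x=g_\gamma x^\delta=(g_\gamma x)^\delta=x^{\gamma\delta}$. Hence $\gamma\mapsto g_\gamma$ is a
  -- homomorphism and not an antihomomorphism.
  refine ⟨MonoidHom.mk' g fun γ δ => Subtype.ext ?_, hg⟩
  refine D.gauge_injective_of_central hle hc ζ hζ x.2 (g (γ * δ)).2 (g γ * g δ).2 ?_
  rw [hg, Subgroup.coe_mul, gauge_mul, hg, gauge_twist, hg, twist_mul]

/-- The map of quiver varieties that regards a triple for `Γ` as a triple for `Γ'`. -/
noncomputable def restrictMap (hle : Γ' ≤ Γ) (hc : ∀ a ∈ Γ', ∀ b ∈ Γ, a * b = b * a)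
    (ζ : Parameter Γ') : D.variety (ζ.sigma hle hc) → (D.restrict hle).variety ζ :=
  Quotient.map (fun x => ⟨x, D.level_sigma_subset hle hc ζ x.2⟩) (by
    rintro x y ⟨g, hg, hxy⟩
    exact ⟨g, D.gaugeGroup_le_restrict hle hg, hxy⟩)

variable (hle : Γ' ≤ Γ) (hc : ∀ a ∈ Γ', ∀ b ∈ Γ, a * b = b * a) (ζ : Parameter Γ')

theorem restrictMap_point (x : D.level (ζ.sigma hle hc)) :
    D.restrictMap hle hc ζ (D.point _ x) =
      (D.restrict hle).point ζ ⟨x, D.level_sigma_subset hle hc ζ x.2⟩ := rfl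

theorem exists_point_eq {ζ : Parameter Γ} (p : D.variety ζ) : ∃ x, D.point ζ x = p :=
  Quotient.exists_rep p

theorem continuous_restrictMap : Continuous (D.restrictMap hle hc ζ) := by
  have hq : Topology.IsQuotientMap (D.point (ζ.sigma hle hc)) := isQuotientMap_quotient_mk'
  rw [hq.continuous_iff]
  exact ((D.restrict hle).continuous_point ζ).comp
    (Continuous.subtype_mk continuous_subtype_val _)

/-- The level set for $\Gamma$ is the closed equivariant locus in the level set for $\Gamma'$, and
the quotient map of the latter is closed. This replaces a direct proof that the inverse is
continuous. -/
theorem isClosedMap_restrictMap : IsClosedMap (D.restrictMap hle hc ζ) := by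
  intro F hF
  have hsurj : Function.Surjective (D.point (ζ.sigma hle hc)) := D.exists_point_eq
  rw [← Set.image_preimage_eq F hsurj, Set.image_image]
  let e : D.level (ζ.sigma hle hc) → (D.restrict hle).level ζ :=
    fun x => ⟨x, D.level_sigma_subset hle hc ζ x.2⟩
  have hind : Topology.IsInducing e := Topology.IsInducing.subtypeVal.of_comp_iff.mp
    Topology.IsInducing.subtypeVal
  have hrange : Set.range e = Subtype.val ⁻¹' {x | D.IsEquivariant x} := by
    ext x
    constructor
    · rintro ⟨y, rfl⟩
      exact y.2.1
    · intro hx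
      exact ⟨⟨x, (D.mem_level_sigma_iff hle hc ζ x).mpr ⟨x.2, hx⟩⟩, rfl⟩
  have he : IsClosedMap e := hind.isClosedMap (by
    rw [hrange]
    exact D.isClosed_isEquivariant.preimage continuous_subtype_val)
  have h1 := (D.restrict hle).isClosedMap_point ζ _ (he _
    (hF.preimage (D.continuous_point (ζ.sigma hle hc))))
  rw [Set.image_image] at h1
  exact h1

/-- If $u$ carries $x$ to $y$, both equivariant, then $\rho(\gamma)u$ and $u\rho(\gamma)$ both carry
$x$ to $y^\gamma$; by freeness they agree, so $u\in U_\Gamma(V)$. -/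
theorem restrictMap_injective (hζ : (D.restrict hle).IsGeneric ζ) :
    Function.Injective (D.restrictMap hle hc ζ) := by
  intro p q hpq
  obtain ⟨x, rfl⟩ := D.exists_point_eq p
  obtain ⟨y, rfl⟩ := D.exists_point_eq q
  rw [restrictMap_point, restrictMap_point, point_eq_iff] at hpq
  obtain ⟨u, hu, huxy⟩ := hpq
  rw [point_eq_iff]
  refine ⟨u, Subgroup.mem_centralizer_iff.mpr ?_, huxy⟩
  rintro _ ⟨γ, rfl⟩
  have hρ := D.rhoV_mem_gaugeGroup hle hc γ
  refine D.gauge_injective_of_central hle hc ζ hζ (D.level_sigma_subset hle hc ζ x.2)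
    (Subgroup.mul_mem _ hρ hu) (Subgroup.mul_mem _ hu hρ) ?_
  rw [gauge_mul, gauge_mul, (D.isEquivariant_iff _).mp x.2.1, gauge_twist, huxy]
  exact (D.isEquivariant_iff _).mp y.2.1 γ

/-- The representation `Γ → U_{Γ'}(V)`. -/
noncomputable def rhoGauge : Γ →* (D.restrict hle).gaugeGroup :=
  D.rhoV.codRestrict _ (D.rhoV_mem_gaugeGroup hle hc)

/-- For an equivariant triple the induced action is the given $\rho$. Conversely, gauging by a
unitary intertwiner $U$ from $g$ to $\rho$ makes the triple equivariant, and $U$ lies in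
$U_{\Gamma'}(V)$ because $g$ and $\rho$ agree on $\Gamma'$. -/
theorem range_restrictMap (hζ : (D.restrict hle).IsGeneric ζ) :
    Set.range (D.restrictMap hle hc ζ) = D.fixedLocus hle hc ζ := by
  ext p
  constructor
  · rintro ⟨q, rfl⟩
    obtain ⟨x, rfl⟩ := D.exists_point_eq q
    have hx := (D.isEquivariant_iff _).mp x.2.1
    refine ⟨fun γ => ?_, ⟨x, D.level_sigma_subset hle hc ζ x.2⟩, D.rhoGauge hle hc, rfl, hx,
      LinearEquiv.refl ℂ V, fun γ u => rfl⟩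
    exact (((D.restrict hle).point_eq_iff ζ ⟨x, D.level_sigma_subset hle hc ζ x.2⟩
      ⟨D.twist γ x, D.twist_mem_level hle hc ζ γ x (D.level_sigma_subset hle hc ζ x.2)⟩).mpr
      ⟨D.rhoV γ, D.rhoV_mem_gaugeGroup hle hc γ, hx γ⟩).symm
  · rintro ⟨-, x, g, rfl, hg, T, hT⟩
    obtain ⟨U, hU⟩ := exists_unitary_intertwiner (fun γ => (g γ : unitary (V →L[ℂ] V))) D.rhoV
      (ContinuousLinearEquiv.unitsEquiv ℂ V |>.symm T.toContinuousLinearEquiv)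
      fun γ => ContinuousLinearMap.ext fun u => hT γ u
    have hUmem : U ∈ (D.restrict hle).gaugeGroup := by
      refine Subgroup.mem_centralizer_iff.mpr ?_
      rintro _ ⟨γ, rfl⟩
      have h1 := hU (Subgroup.inclusion hle γ)
      rw [hg.eq_rhoV hc ζ hζ x.2] at h1
      exact h1.symm
    have hy := (D.restrict hle).gauge_mem_level ζ hUmem x.2
    have hyeq : D.IsEquivariant (gauge U (x : Triple V W)) := by
      rw [isEquivariant_iff]
      intro γ
      rw [← gauge_mul, ← hU, gauge_mul, hg γ, gauge_twist]
    refine ⟨D.point _ ⟨_, (D.mem_level_sigma_iff hle hc ζ _).mpr ⟨hy, hyeq⟩⟩, ?_⟩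
    rw [restrictMap_point]
    exact (((D.restrict hle).point_eq_iff ζ _ _).mpr ⟨U, hUmem, rfl⟩).symm

end CentralSubgroup

end Datum

end QuiverVariety

open QuiverVariety in
theorem theorem4p9
    {Γ Γ' : Subgroup (Matrix.SpecialLinearGroup (Fin 2) ℂ)} [Finite Γ]
    (hle : Γ' ≤ Γ) (hc : ∀ a ∈ Γ', ∀ b ∈ Γ, a * b = b * a)
    {V W : Type*}
    [NormedAddCommGroup V] [InnerProductSpace ℂ V] [CompleteSpace V] [FiniteDimensional ℂ V]
    [NormedAddCommGroup W] [InnerProductSpace ℂ W] [CompleteSpace W] [FiniteDimensional ℂ W]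
    (D : Datum Γ V W) (ζ : Parameter Γ') (hζ : (D.restrict hle).IsGeneric ζ) :
    (∀ x : (D.restrict hle).level ζ, (D.restrict hle).point ζ x ∈ D.fixedPoints hle hc ζ →
      ∃ g : Γ →* (D.restrict hle).gaugeGroup, D.Induces hle x g ∧
        (∀ γ : Γ', (g (Subgroup.inclusion hle γ) : unitary (V →L[ℂ] V)) =
          (D.restrict hle).rhoV γ) ∧
        ∀ (γ : Γ), ∀ u ∈ (D.restrict hle).gaugeGroup,
          gauge u (x : Triple V W) = D.twist γ x → u = g γ) ∧
    ∃ Φ : D.variety (ζ.sigma hle hc) ≃ₜ D.fixedLocus hle hc ζ,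
      ∀ x : D.level (ζ.sigma hle hc),
        (Φ (D.point (ζ.sigma hle hc) x) : (D.restrict hle).variety ζ) =
          (D.restrict hle).point ζ ⟨x, D.level_sigma_subset hle hc ζ x.2⟩ := by
  refine ⟨fun x hx => ?_, ?_⟩
  · obtain ⟨g, hg⟩ := D.exists_induces hle hc ζ hζ x hx
    exact ⟨g, hg, hg.eq_rhoV hc ζ hζ x.2, fun γ u hu h =>
      D.gauge_injective_of_central hle hc ζ hζ x.2 hu (g γ).2 (h.trans (hg γ).symm)⟩
  · have hemb := Topology.IsClosedEmbedding.of_continuous_injective_isClosedMap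
      (D.continuous_restrictMap hle hc ζ) (D.restrictMap_injective hle hc ζ hζ)
      (D.isClosedMap_restrictMap hle hc ζ)
    exact ⟨hemb.isEmbedding.toHomeomorph.trans
      (Homeomorph.setCongr (D.range_restrictMap hle hc ζ hζ)), fun x => rfl⟩
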